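/- Let $X\subset\mathbb{C}^{n+1}$ (coordinates $x_0,\dots,x_n$) be an irreducible affine algebraic curve not contained in any coordinate hyperplane, with vanishing ideal $I(X)$, and let $j\in\{0,\dots,n\}$. A *critical point* of $X$ with respect to $x_j$ is a point $x\in X$ at which the Jacobian matrix of the polynomials in $I(X)$, with its $j$-th column removed, has a nonzero null vector. A *Puiseux series* is an element of $\mathbb{C}\{\!\{t\}\!\}=\bigcup_{m\ge1}\mathbb{C}((t^{1/m}))$; for a nonzero series, $\mathrm{val}$ is its lowest exponent with nonzero coefficient, and $\mathrm{val}(0)=\infty$. For a nonzero $\tau\in\mathbb{C}$ say that $\tau$ is *inside the endgame operating zone of $X$ with respect to $x_j$* if no critical point $x$ of $X$ with respect to $x_j$ satisfies $0<|x_j|\le|\tau|$, and if, for every locally convergent tuple $y\in\mathbb{C}\{\!\{t\}\!\}^{n+1}$ of Puiseux series with nonnegative valuations that lies in the variety of $I(X)$ and has $y_j=t$ (a branch of $X$ around a point of $X$ on $x_j=0$), all the series $y_k$ converge absolutely for $|t|\le|\tau|$. Let $\tau\neq0$ be inside the endgame operating zone of $X$ with respect to $x_j$, let $p\in X$ with $p_j=\tau$,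 and let $P:[0,1]\to X$ be a continuous path with $P_j(s)=\tau s$ for $s\in[0,1]$ and $P(1)=p$. Consider the following algorithm. Continue the path from $P(1)=p$ around the unit circle, i.e. let $\theta\mapsto P(e^{i\theta})$ be a continuous curve $\mathbb{R}\to X$ with $P_j(e^{i\theta})=\tau e^{i\theta}$ and value $p$ at $\theta=0$ (it need not be $2\pi$-periodic). Let the cycle number $c$ be the least positive integer such that this curve returns to $p$ at angle $2\pi c$. For each $k=0,\dots,n$ let $u_k$ be the smallest integer $\ell\ge0$ with $$\int_0^{2\pi}\frac{P_k(e^{c\,i\theta})}{(e^{i\theta})^{\ell}}\,d\theta\neq0 .$$ Output $r=u/\gcd(u_0,\dots,u_n)\in\mathbb{Z}_{\ge0}^{n+1}$. Then the algorithm terminates and has exactly one output $r$; it is a primitive integer vector (the gcd of its entries is $1$) with $r_j>0$; and there is a point $y\in\mathbb{C}\{\!\{t\}\!\}^{n+1}$ in the variety of $I(X)$ over $\mathbb{C}\{\!\{t\}\!\}$, with all coordinates nonzero, whose coordinates converge for all $t\in[0,1]$, with $y(s)=P(s)$ for all $s\in[0,1]$ and $$\mathrm{val}(y)=\frac1{r_j}\,r\in\mathbb{Q}_{\ge0}^{n+1}.$$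 -/

import Mathlib

noncomputable section

/-! ### Puiseux series -/

/-- `x`, a Hahn series over `ℂ` with rational exponents, is a Puiseux series: for some `m ≥ 1` all its
exponents lie in `(1/m) ℤ`. (The support of a Hahn series over `ℚ` is well ordered, so it is then
bounded below, i.e. `x ∈ ℂ((t^{1/m}))`.) -/
def IsPuiseux (x : HahnSeries ℚ ℂ) : Prop :=
  ∃ m : ℕ, 0 < m ∧ ∀ q ∈ x.support, ∃ k : ℤ, q = (k : ℚ) / (m : ℚ)

/-- The series `∑ c_q t^q` converges (absolutely) at the real point `t = s` and its sum is `v`.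
The convention `0 ^ 0 = 1` gives the value `c_0` at `s = 0` for a series without negative exponents;
the notion is only used at `s = 0` for such series. -/
def PuiseuxHasValueAt (x : HahnSeries ℚ ℂ) (s : ℝ) (v : ℂ) : Prop :=
  HasSum (fun q : ℚ => x.coeff q * ((s ^ (q : ℝ) : ℝ) : ℂ)) v

/-- The series `∑ c_q t^q` converges absolutely at `t = ρ`; for `ρ > 0` and a series
without negative exponents this is absolute convergence on the whole disk `|t| ≤ ρ`. -/
def PuiseuxConvergesAt (x : HahnSeries ℚ ℂ) (ρ : ℝ) : Prop :=
  Summable (fun q : ℚ => x.coeff q * ((ρ ^ (q : ℝ) : ℝ) : ℂ))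

/-! ### Affine curves and the endgame operating zone -/

/-- `X ⊆ ℂ^{n+1}` is an irreducible algebraic curve: it is the zero set of its vanishing ideal `I(X)`,
this ideal is prime, and the coordinate ring has transcendence degree (dimension) one. -/
structure IsIrreducibleCurve {n : ℕ} (X : Set (Fin (n + 1) → ℂ)) : Prop where
  closed : MvPolynomial.zeroLocus ℂ (MvPolynomial.vanishingIdeal ℂ X) = X
  prime : (MvPolynomial.vanishingIdeal ℂ X).IsPrime
  dim_one : Algebra.trdeg ℂ (MvPolynomial (Fin (n + 1)) ℂ ⧸ MvPolynomial.vanishingIdeal ℂ X) = 1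

/-- `x ∈ X` is a critical point of `X` with respect to the coordinate `x_j`: the Jacobian matrix at `x`
of the polynomials vanishing on `X`, with its `j`-th column removed, has a nonzero null vector
(written here as a vector `ν` whose `j`-th entry is `0`). -/
def IsCriticalPoint {n : ℕ} (X : Set (Fin (n + 1) → ℂ)) (j : Fin (n + 1))
    (x : Fin (n + 1) → ℂ) : Prop :=
  x ∈ X ∧ ∃ ν : Fin (n + 1) → ℂ, ν ≠ 0 ∧ ν j = 0 ∧
    ∀ f ∈ MvPolynomial.vanishingIdeal ℂ X,
      ∑ i, MvPolynomial.eval x (MvPolynomial.pderiv i f) * ν i = 0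

/-- `y` is a Puiseux parametrization, by the value `t` of the coordinate `x_j`, of a branch of `X`
around a point of `X` lying on `x_j = 0`: a tuple of locally convergent Puiseux series with nonnegative
valuations, in the variety of `I(X)`, with `y_j = t`. -/
structure IsBranchAtZero {n : ℕ} (X : Set (Fin (n + 1) → ℂ)) (j : Fin (n + 1))
    (y : Fin (n + 1) → HahnSeries ℚ ℂ) : Prop where
  puiseux : ∀ k, IsPuiseux (y k)
  nonneg : ∀ k, 0 ≤ (y k).orderTop
  locally_convergent : ∃ ε : ℝ, 0 < ε ∧ ∀ k, PuiseuxConvergesAt (y k) ε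
  mem : y ∈ MvPolynomial.zeroLocus (HahnSeries ℚ ℂ) (MvPolynomial.vanishingIdeal ℂ X)
  coord : y j = HahnSeries.single (1 : ℚ) (1 : ℂ)

/-- `τ` is inside the endgame operating zone of `X` with respect to `x_j`: no critical point `x` of `X`
has `0 < |x_j| ≤ |τ|`, and the Puiseux series of all branches of `X` around points of `X` on `x_j = 0`
converge on the disk of radius `|τ|`. -/
structure InEndgameZone {n : ℕ} (X : Set (Fin (n + 1) → ℂ)) (j : Fin (n + 1)) (τ : ℂ) : Prop where
  noncritical : ∀ x, IsCriticalPoint X j x → x j ≠ 0 → ‖τ‖ < ‖x j‖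
  convergent : ∀ y, IsBranchAtZero X j y → ∀ k, PuiseuxConvergesAt (y k) ‖τ‖

/-! ### The input, the run and the output of the algorithm -/

/-- `P` is a continuous path `[0,1] → X` with `P_j(s) = τ s` and `P(1) = p`. -/
structure IsTrackedPath {n : ℕ} (X : Set (Fin (n + 1) → ℂ)) (j : Fin (n + 1)) (τ : ℂ)
    (p : Fin (n + 1) → ℂ) (P : ℝ → Fin (n + 1) → ℂ) : Prop where
  continuousOn : ContinuousOn P (Set.Icc 0 1)
  mem : ∀ s ∈ Set.Icc (0 : ℝ) 1, P s ∈ X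
  coord : ∀ s ∈ Set.Icc (0 : ℝ) 1, P s j = τ * (s : ℂ)
  start : P 1 = p

/-- `Q θ` is the value `P(e^{iθ})` of the path continued around the unit circle from `P(1) = p`:
a continuous curve in `X` with `Q_j(θ) = τ e^{iθ}` and `Q(0) = p`. -/
structure IsCircleContinuation {n : ℕ} (X : Set (Fin (n + 1) → ℂ)) (j : Fin (n + 1)) (τ : ℂ)
    (p : Fin (n + 1) → ℂ) (Q : ℝ → Fin (n + 1) → ℂ) : Prop where
  continuous : Continuous Q
  mem : ∀ θ, Q θ ∈ X
  coord : ∀ θ, Q θ j = τ * Complex.exp (Complex.I * (θ : ℂ))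
  start : Q 0 = p

/-- `c` is the cycle number: the least positive integer with `P(e^{2πic}) = p`. -/
def IsCycleNumber {n : ℕ} (p : Fin (n + 1) → ℂ) (Q : ℝ → Fin (n + 1) → ℂ) (c : ℕ) : Prop :=
  IsLeast {m : ℕ | 0 < m ∧ Q (2 * Real.pi * (m : ℝ)) = p} c

/-- The Cauchy integral `∫₀^{2π} P_k(e^{c iθ}) / (e^{iθ})^l dθ`. -/
def cauchyIntegral {n : ℕ} (Q : ℝ → Fin (n + 1) → ℂ) (c : ℕ) (k : Fin (n + 1)) (l : ℕ) : ℂ :=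
  ∫ θ in (0 : ℝ)..(2 * Real.pi), Q ((c : ℝ) * θ) k / Complex.exp (Complex.I * (θ : ℂ)) ^ l

/-- `r` is the output of the algorithm on the input `X, j, τ, p`: with the cycle number `c`, and with
`u_k` the first `l = 0, 1, 2, …` whose Cauchy integral is nonzero (the loop for `k` stops there),
`r = u / gcd(u)`. -/
def IsAlgorithmOutput {n : ℕ} (X : Set (Fin (n + 1) → ℂ)) (j : Fin (n + 1)) (τ : ℂ)
    (p : Fin (n + 1) → ℂ) (r : Fin (n + 1) → ℕ) : Prop :=
  ∃ (Q : ℝ → Fin (n + 1) → ℂ) (c : ℕ) (u : Fin (n + 1) → ℕ),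
    IsCircleContinuation X j τ p Q ∧ IsCycleNumber p Q c ∧
    (∀ k, IsLeast {l : ℕ | cauchyIntegral Q c k l ≠ 0} (u k)) ∧
    ∀ k, r k = u k / Finset.univ.gcd u

end

/-!
The output of the algorithm is read off from one Puiseux expansion of the tracked path.

*Expansion near the origin.* Two coordinates `x_j`, `x_k` on a curve satisfy a polynomial relation
(`IsIrreducibleCurve.exists_relation`), so `s ↦ P_k(s)` is a continuous root of a family of polynomials
whose coefficients are analytic in `s`. Such a root is an analytic function of `s ^ (1 / m)`
(`hasPuiseuxExpansion_of_root`). This is the Newton-Puiseux algorithm run along the curve: for a root of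
multiplicity `μ`, the variable is centered at the analytic simple root of the derivative of order
`μ - 1`, which kills the term of degree `μ - 1`, and then rescaled by the steepest slope of the Newton
polygon. The rescaled curve stays bounded, and being connected it converges to a single root of the limit
polynomial (`exists_isRoot_tendsto_of_coeff`); that root has multiplicity less than `μ`.

*From germ to disk.* In a common root `u = s ^ (1 / m)` the path is given by power series `A_k(u)`. After
the substitution `t = τ s` they form a branch of `X` at `x_j = 0`, so the convergence half of the endgame
condition makes them converge absolutely on `|u| ≤ 1`
(`IsTrackedPath.exists_isDiskParametrization`). The identity theorem for power series puts all their
values into `X`. The other half of the condition, the absence of critical points, makes `x_j` locally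
injective on `X` (`exists_nhds_injOn_coord`) and hence lifts of curves unique
(`InEndgameZone.lift_unique`). So `P(u ^ m) = A(u)` on `[0, 1]`, and the only continuation around the
circle is `θ ↦ A(exp (i θ / m))`.

*Reading off the orders.* If this continuation closes up at `2 π c`, then comparing Fourier coefficients
gives `m ∣ c i` for every exponent `i` of every `A_k`. The Cauchy integrals are then `2 π` times the
coefficients of `A_k` with respect to `u ^ (m / c)`, so `u_k = c a_k / m` with `a_k` the order of `A_k`, while the
valuation of `A_k(t ^ (1 / m))` is `a_k / m`. As `a_j = m`, dividing by `u_j = c` gives the claim.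
-/

/-! ### Continuous roots of polynomials with convergent coefficients -/

open Filter Topology Polynomial in
/-- Continuous solutions of a polynomial equation with convergent coefficients are bounded, provided
the top coefficient does not tend to zero. -/
theorem isBoundedUnder_root {α : Type*} {l : Filter α} {μ : ℕ} {β : ℕ → α → ℂ} {b : ℕ → ℂ}
    {w : α → ℂ} (hb : b μ ≠ 0) (hβ : ∀ i ≤ μ, Tendsto (β i) l (𝓝 (b i)))
    (hw : ∀ᶠ v in l, ∑ i ∈ Finset.range (μ + 1), β i v * w v ^ i = 0) :
    IsBoundedUnder (· ≤ ·) l (fun v => ‖w v‖) := by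
  have hlim : Tendsto (fun v => 1 + (∑ i ∈ Finset.range μ, ‖β i v‖) / ‖β μ v‖) l
      (𝓝 (1 + (∑ i ∈ Finset.range μ, ‖b i‖) / ‖b μ‖)) := by
    refine Tendsto.const_add _ (Tendsto.div (tendsto_finsetSum _ fun i hi => ?_)
      (hβ μ le_rfl).norm (by simpa using hb))
    exact (hβ i (Finset.mem_range.1 hi).le).norm
  refine hlim.isBoundedUnder_le.mono_le ?_
  filter_upwards [hw, (hβ μ le_rfl).eventually_ne hb] with v hv hne
  -- if `1 ≤ ‖w v‖`, dividing the equation by `w v ^ (μ - 1)` bounds `‖w v‖` by the quotient above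
  have hpos : 0 < ‖β μ v‖ := norm_pos_iff.2 hne
  have hS : 0 ≤ ∑ i ∈ Finset.range μ, ‖β i v‖ := Finset.sum_nonneg fun _ _ => norm_nonneg _
  rcases le_total ‖w v‖ 1 with h1 | h1
  · exact h1.trans (le_add_of_nonneg_right (by positivity))
  rcases μ with _ | μ
  · simp at hv
    exact absurd hv hne
  refine le_add_of_nonneg_of_le zero_le_one ((le_div_iff₀ hpos).2 ?_)
  have hp : 0 < ‖w v‖ ^ μ := by positivity
  refine le_of_mul_le_mul_right ?_ hp
  rw [Finset.sum_range_succ] at hv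
  have e : ‖w v‖ * ‖β (μ + 1) v‖ * ‖w v‖ ^ μ
      = ‖∑ i ∈ Finset.range (μ + 1), β i v * w v ^ i‖ := by
    rw [eq_neg_of_add_eq_zero_left hv, norm_neg, norm_mul, norm_pow, pow_succ]
    ring
  rw [e, Finset.sum_mul]
  refine (norm_sum_le _ _).trans (Finset.sum_le_sum fun i hi => ?_)
  rw [norm_mul, norm_pow]
  exact mul_le_mul_of_nonneg_left
    (pow_le_pow_right₀ h1 (Nat.lt_succ_iff.1 (Finset.mem_range.1 hi))) (norm_nonneg _)

open Polynomial in
/-- A polynomial is bounded below away from its roots. -/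
theorem Polynomial.pow_le_norm_eval {Q : ℂ[X]} {δ : ℝ} (hδ : 0 ≤ δ) {z : ℂ}
    (h : ∀ r ∈ Q.roots, δ ≤ ‖z - r‖) :
    ‖Q.leadingCoeff‖ * δ ^ Q.natDegree ≤ ‖Q.eval z‖ := by
  have hs := IsAlgClosed.splits Q
  rw [hs.eval_eq_prod_roots z, norm_mul]
  refine mul_le_mul_of_nonneg_left ?_ (norm_nonneg _)
  rw [hs.natDegree_eq_card_roots]
  have key : ∀ s : Multiset ℂ, (∀ r ∈ s, δ ≤ ‖z - r‖) →
      δ ^ s.card ≤ ‖(s.map fun r => z - r).prod‖ := by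
    intro s
    induction s using Multiset.induction with
    | empty => simp
    | cons a s ih =>
      intro hs
      simp only [Multiset.card_cons, Multiset.map_cons, Multiset.prod_cons, norm_mul, pow_succ']
      exact mul_le_mul (hs a (by simp)) (ih fun r hr => hs r (by simp [hr])) (by positivity)
        (norm_nonneg _)
  exact key _ h

open Filter Topology Polynomial in
/-- Along a continuous curve on which a nonzero polynomial tends to zero, the argument tends to a
root: the curve is connected, so it cannot switch between small disjoint disks around the roots. -/
theorem exists_isRoot_tendsto {Q : ℂ[X]} (hQ : Q ≠ 0) {w : ℝ → ℂ}
    (hw : ∀ᶠ v in 𝓝[>] (0 : ℝ), ContinuousAt w v)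
    (h0 : Tendsto (fun v => Q.eval (w v)) (𝓝[>] 0) (𝓝 0)) :
    ∃ c, Q.IsRoot c ∧ Tendsto w (𝓝[>] 0) (𝓝 c) := by
  have hclose : ∀ δ > 0, ∀ᶠ v in 𝓝[>] (0 : ℝ), ∃ r ∈ Q.roots.toFinset, w v ∈ Metric.ball r δ := by
    intro δ hδ
    have hpos : 0 < ‖Q.leadingCoeff‖ * δ ^ Q.natDegree :=
      mul_pos (norm_pos_iff.2 (leadingCoeff_ne_zero.2 hQ)) (pow_pos hδ _)
    filter_upwards [h0.norm.eventually_lt_const (by simpa using hpos)] with v hv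
    by_contra! hcon
    refine absurd hv (not_lt.2 (Polynomial.pow_le_norm_eval hδ.le fun r hr => ?_))
    have := hcon r (by simpa using hr)
    simpa [dist_eq_norm] using this
  obtain ⟨δ, hδ, hsep⟩ : ∃ δ > 0, ∀ r ∈ Q.roots.toFinset, ∀ r' ∈ Q.roots.toFinset,
      r ≠ r' → 2 * δ ≤ dist r r' := by
    have hfin := Q.roots.toFinset.finite_toSet
    obtain ⟨δ, hδ, h⟩ : ∃ δ > 0, ∀ r ∈ Q.roots.toFinset, ∀ r' ∈ Q.roots.toFinset,
        r ≠ r' → δ ≤ dist r r' := by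
      by_cases hn : (Q.roots.toFinset : Set ℂ).Nontrivial
      · exact ⟨_, (Set.Finite.infsep_pos_iff_nontrivial hfin).2 hn, fun r hr r' hr' hne =>
          hn.le_infsep_iff.1 le_rfl r hr r' hr' hne⟩
      · rw [Set.not_nontrivial_iff] at hn
        exact ⟨1, one_pos, fun r hr r' hr' hne => absurd (hn hr hr') hne⟩
    exact ⟨δ / 2, by positivity, fun r hr r' hr' hne => by linarith [h r hr r' hr' hne]⟩
  obtain ⟨ε, hε, hball⟩ := mem_nhdsGT_iff_exists_Ioo_subset.1 (hw.and (hclose δ hδ))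
  have hcont : ContinuousOn w (Set.Ioo 0 ε) := fun v hv => (hball hv).1.continuousWithinAt
  have hconn := (isPreconnected_Ioo (a := (0 : ℝ)) (b := ε)).image w hcont
  have hε' : (0 : ℝ) < ε := hε
  have hmid : ε / 2 ∈ Set.Ioo 0 ε := ⟨by linarith, by linarith⟩
  obtain ⟨c, hc, hwc⟩ := (hball hmid).2
  have hsub : w '' Set.Ioo 0 ε ⊆ Metric.ball c δ := by
    refine hconn.subset_left_of_subset_union Metric.isOpen_ball
      (isOpen_biUnion fun r (_ : r ∈ {r | r ∈ Q.roots.toFinset ∧ r ≠ c}) =>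
        Metric.isOpen_ball (x := r) (ε := δ)) ?_ ?_ ⟨_, ⟨_, hmid, rfl⟩, hwc⟩
    · rw [Set.disjoint_iUnion₂_right]
      exact fun r hr => Metric.ball_disjoint_ball (by linarith [hsep c hc r hr.1 hr.2.symm])
    · rintro _ ⟨v, hv, rfl⟩
      obtain ⟨r, hr, hwr⟩ := (hball hv).2
      by_cases hrc : r = c
      · exact Or.inl (hrc ▸ hwr)
      · exact Or.inr (Set.mem_biUnion (show r ∈ {r | r ∈ Q.roots.toFinset ∧ r ≠ c} from ⟨hr, hrc⟩) hwr)
  refine ⟨c, (mem_roots hQ).1 (by simpa using hc), Metric.tendsto_nhds.2 fun η hη => ?_⟩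
  filter_upwards [hclose (min η δ) (lt_min hη hδ), Ioo_mem_nhdsGT hε'] with v hv hvε
  obtain ⟨r, hr, hwr⟩ := hv
  have h1 : dist (w v) c < δ := hsub ⟨v, hvε, rfl⟩
  have h2 : dist (w v) r < min η δ := hwr
  have hrc : r = c := by
    by_contra hne
    have := hsep r hr c hc hne
    have := dist_triangle_left r c (w v)
    linarith [min_le_right η δ]
  exact hrc ▸ h2.trans_le (min_le_left _ _)

open Filter Topology Polynomial in
/-- A continuous solution of a polynomial equation whose coefficients converge, with top
coefficient not tending to zero, converges to a root of the limit polynomial. -/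
theorem exists_isRoot_tendsto_of_coeff {Q : ℂ[X]} {μ : ℕ} (hdeg : Q.natDegree ≤ μ)
    (hQ : Q.coeff μ ≠ 0) {β : ℕ → ℝ → ℂ} {w : ℝ → ℂ}
    (hβ : ∀ i ≤ μ, Tendsto (β i) (𝓝[>] 0) (𝓝 (Q.coeff i)))
    (hw : ∀ᶠ v in 𝓝[>] (0 : ℝ), ∑ i ∈ Finset.range (μ + 1), β i v * w v ^ i = 0)
    (hcont : ∀ᶠ v in 𝓝[>] (0 : ℝ), ContinuousAt w v) :
    ∃ c, Q.IsRoot c ∧ Tendsto w (𝓝[>] 0) (𝓝 c) := by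
  have hbdd := isBoundedUnder_root hQ hβ hw
  refine exists_isRoot_tendsto (by rintro rfl; simp at hQ) hcont ?_
  have hlim : Tendsto (fun v => ∑ i ∈ Finset.range (μ + 1), (Q.coeff i - β i v) * w v ^ i)
      (𝓝[>] 0) (𝓝 0) := by
    rw [← Finset.sum_const_zero (s := Finset.range (μ + 1)) (M := ℂ)]
    refine tendsto_finsetSum _ fun i hi => ?_
    refine Tendsto.zero_mul_isBoundedUnder_le ?_ ?_
    · have := (hβ i (Nat.lt_succ_iff.1 (Finset.mem_range.1 hi))).const_sub (Q.coeff i)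
      simpa using this
    · obtain ⟨C, hC⟩ := hbdd
      rw [eventually_map] at hC
      refine ⟨C ^ i, eventually_map.2 ?_⟩
      filter_upwards [hC] with v hv
      simpa [norm_pow] using pow_le_pow_left₀ (norm_nonneg _) hv i
  refine hlim.congr' ?_
  filter_upwards [hw] with v hv
  rw [eval_eq_sum_range' (Nat.lt_succ_of_le hdeg)]
  simp only [sub_mul, Finset.sum_sub_distrib, hv, sub_zero]

/-! ### Analytic families of polynomials -/

open Polynomial in
/-- A family `F u` of polynomials in one variable, of bounded degree, whose coefficients are analytic
functions of the parameter `u` near `0`. -/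
structure AnalyticPolyFamily (F : ℂ → ℂ[X]) (d : ℕ) : Prop where
  analyticAt_coeff : ∀ i, AnalyticAt ℂ (fun u => (F u).coeff i) 0
  natDegree_le : ∀ u, (F u).natDegree ≤ d

namespace AnalyticPolyFamily

open Polynomial Filter Topology

variable {F : ℂ → ℂ[X]} {d : ℕ}

theorem analyticAt_eval (hF : AnalyticPolyFamily F d) (c : ℂ) :
    AnalyticAt ℂ (fun q : ℂ × ℂ => (F q.1).eval q.2) (0, c) := by
  have h : (fun q : ℂ × ℂ => (F q.1).eval q.2)
      = fun q => ∑ i ∈ Finset.range (d + 1), (F q.1).coeff i * q.2 ^ i := by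
    ext q
    exact eval_eq_sum_range' (Nat.lt_succ_of_le (hF.natDegree_le q.1)) q.2
  rw [h]
  refine Finset.analyticAt_fun_sum _ fun i _ => AnalyticAt.mul ?_ (analyticAt_snd.pow i)
  exact AnalyticAt.comp (f := Prod.fst) (g := fun u => (F u).coeff i) (hF.analyticAt_coeff i)
    analyticAt_fst

theorem hasseDeriv (hF : AnalyticPolyFamily F d) (k : ℕ) :
    AnalyticPolyFamily (fun u => Polynomial.hasseDeriv k (F u)) d where
  analyticAt_coeff i := by
    simp only [hasseDeriv_coeff]
    exact analyticAt_const.mul (hF.analyticAt_coeff _)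
  natDegree_le u :=
    (natDegree_hasseDeriv_le _ _).trans ((Nat.sub_le _ _).trans (hF.natDegree_le u))

theorem analyticAt_eval_comp (hF : AnalyticPolyFamily F d) {φ : ℂ → ℂ} (hφ : AnalyticAt ℂ φ 0) :
    AnalyticAt ℂ (fun u => (F u).eval (φ u)) 0 :=
  AnalyticAt.comp (f := fun u => (u, φ u)) (g := fun q : ℂ × ℂ => (F q.1).eval q.2)
    (hF.analyticAt_eval (φ 0)) (analyticAt_id.prod hφ)

theorem taylor (hF : AnalyticPolyFamily F d) {φ : ℂ → ℂ} (hφ : AnalyticAt ℂ φ 0) :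
    AnalyticPolyFamily (fun u => Polynomial.taylor (φ u) (F u)) d where
  analyticAt_coeff i := by
    simp only [taylor_coeff]
    exact (hF.hasseDeriv i).analyticAt_eval_comp hφ
  natDegree_le u := by rw [natDegree_taylor]; exact hF.natDegree_le u

/-- The implicit function theorem: a simple root at parameter `0` extends to an analytic root. -/
theorem exists_analyticAt_root (hF : AnalyticPolyFamily F d) {c : ℂ} (h0 : (F 0).eval c = 0)
    (h1 : (derivative (F 0)).eval c ≠ 0) :
    ∃ φ : ℂ → ℂ, AnalyticAt ℂ φ 0 ∧ φ 0 = c ∧ ∀ᶠ u in 𝓝 0, (F u).eval (φ u) = 0 := by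
  set f : ℂ × ℂ → ℂ := fun q => (F q.1).eval q.2 with hf
  have han : AnalyticAt ℂ f (0, c) := hF.analyticAt_eval c
  have cdf : ContDiffAt ℂ ⊤ f (0, c) := han.contDiffAt
  have hd : HasFDerivAt (fun z : ℂ => f (0, z))
      (fderiv ℂ f (0, c) ∘L .inr ℂ ℂ ℂ) c :=
    HasFDerivAt.comp (f := fun z : ℂ => ((0 : ℂ), z)) c han.differentiableAt.hasFDerivAt
      (hasFDerivAt_prodMk_right (0 : ℂ) c)
  have hval : (fderiv ℂ f (0, c) ∘L .inr ℂ ℂ ℂ) 1 = (derivative (F 0)).eval c :=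
    hd.hasDerivAt.unique ((F 0).hasDerivAt c)
  have hinv : (fderiv ℂ f (0, c) ∘L .inr ℂ ℂ ℂ).IsInvertible := by
    refine ⟨ContinuousLinearEquiv.unitsEquivAut ℂ (Units.mk0 _ h1), ?_⟩
    ext
    simp only [ContinuousLinearEquiv.coe_coe, ContinuousLinearEquiv.unitsEquivAut_apply]
    rw [hval]
    simp
  have hne : (⊤ : WithTop ℕ∞) ≠ 0 := by simp
  refine ⟨cdf.implicitFunction hne hinv, ?_, cdf.implicitFunction_apply_self hne hinv, ?_⟩
  · exact (cdf.contDiffAt_implicitFunction hne hinv).analyticAt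
  · filter_upwards [cdf.eventually_apply_implicitFunction hne hinv] with u hu
    exact hu.trans h0

end AnalyticPolyFamily

open Filter Topology in
/-- Division of an analytic function by a power of the variable; the quotient detects whether the
order of vanishing is exactly `n`. -/
theorem AnalyticAt.exists_eq_pow_mul {f : ℂ → ℂ} (hf : AnalyticAt ℂ f 0) {n : ℕ}
    (hn : (n : ℕ∞) ≤ analyticOrderAt f 0) :
    ∃ b : ℂ → ℂ, AnalyticAt ℂ b 0 ∧ (∀ᶠ u in 𝓝 0, f u = u ^ n * b u) ∧
      (analyticOrderAt f 0 = n ↔ b 0 ≠ 0) := by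
  obtain ⟨b, hb, hfb⟩ := (natCast_le_analyticOrderAt hf).1 hn
  simp only [sub_zero, smul_eq_mul] at hfb
  refine ⟨b, hb, hfb, fun h => ?_, fun h => ?_⟩
  · have h2 : analyticOrderAt f 0 = n + analyticOrderAt b 0 := by
      rw [analyticOrderAt_congr hfb, show (fun u => u ^ n * b u) = (fun u : ℂ => u ^ n) * b from rfl,
        analyticOrderAt_mul (by fun_prop) hb]
      congr 1
      have := analyticOrderAt_centeredMonomial (𝕜 := ℂ) (z₀ := 0) (n := n)
      simpa [Pi.pow_def] using this
    rw [h] at h2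
    have h3 : analyticOrderAt b 0 = 0 := by
      cases hb : analyticOrderAt b 0 with
      | top => rw [hb] at h2; simp at h2
      | coe m =>
        rw [hb] at h2
        norm_cast at h2 ⊢
        omega
    exact hb.analyticOrderAt_eq_zero.1 h3
  · exact hf.analyticOrderAt_eq_natCast.2 ⟨b, hb, h, by simpa using hfb⟩

/-! ### The Newton-Puiseux algorithm along a real curve -/

section PuiseuxExpansion

open Polynomial Filter Topology

theorem tendsto_ofReal_nhdsGT_zero : Tendsto (fun s : ℝ => (s : ℂ)) (𝓝[>] 0) (𝓝 0) := by
  have : Tendsto (fun s : ℝ => (s : ℂ)) (𝓝 0) (𝓝 ((0 : ℝ) : ℂ)) :=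
    Complex.continuous_ofReal.tendsto 0
  rw [Complex.ofReal_zero] at this
  exact this.mono_left nhdsWithin_le_nhds

theorem tendsto_pow_nhdsGT_zero {q : ℕ} (hq : q ≠ 0) :
    Tendsto (fun s : ℝ => s ^ q) (𝓝[>] 0) (𝓝[>] 0) := by
  refine tendsto_nhdsWithin_iff.2 ⟨?_, ?_⟩
  · have : Tendsto (fun s : ℝ => s ^ q) (𝓝 0) (𝓝 (0 ^ q)) := (continuous_pow q).tendsto 0
    rw [zero_pow hq] at this
    exact this.mono_left nhdsWithin_le_nhds
  · filter_upwards [self_mem_nhdsWithin] with s hs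
    exact pow_pos (Set.mem_Ioi.1 hs) q

/-- A function on small positive reals has a Puiseux expansion at `0`: after the substitution
`s = u ^ m` it is the restriction of an analytic function of `u`. -/
def HasPuiseuxExpansion (g : ℝ → ℂ) : Prop :=
  ∃ m : ℕ, 0 < m ∧ ∃ h : ℂ → ℂ, AnalyticAt ℂ h 0 ∧ ∀ᶠ u in 𝓝[>] (0 : ℝ), g (u ^ m) = h u

/-- Splitting off the terms of degree at least `μ`. -/
theorem Polynomial.eval_eq_sum_range_add_pow_mul {P : ℂ[X]} {d : ℕ} (hP : P.natDegree ≤ d) (μ : ℕ)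
    (z : ℂ) :
    P.eval z = (∑ i ∈ Finset.range μ, P.coeff i * z ^ i)
      + z ^ μ * ∑ i ∈ Finset.range (d + 1), P.coeff (μ + i) * z ^ i := by
  rw [eval_eq_sum_range' (n := μ + (d + 1)) (by omega), Finset.sum_range_add, Finset.mul_sum]
  congr 1
  exact Finset.sum_congr rfl fun i _ => by rw [pow_add]; ring

/-- If the term of degree `μ - 1` of a polynomial of degree `μ` vanishes but some other term of degree
less than `μ` does not, then all roots have multiplicity less than `μ`. -/
theorem Polynomial.natTrailingDegree_taylor_lt {Q : ℂ[X]} {μ i₀ : ℕ} (hdeg : Q.natDegree ≤ μ)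
    (hμ : Q.coeff μ ≠ 0) (h1 : Q.coeff (μ - 1) = 0) (hi₀ : i₀ < μ) (h0 : Q.coeff i₀ ≠ 0) (c : ℂ) :
    (taylor c Q).natTrailingDegree < μ := by
  rcases eq_or_ne c 0 with rfl | hc
  · rw [taylor_zero]
    exact (natTrailingDegree_le_of_ne_zero h0).trans_lt hi₀
  · refine (natTrailingDegree_le_of_ne_zero (n := μ - 1) ?_).trans_lt (by omega)
    have hd : (hasseDeriv (μ - 1) Q).natDegree < 2 :=
      (natDegree_hasseDeriv_le _ _).trans_lt (by omega)
    rw [taylor_coeff, eval_eq_sum_range' hd]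
    have e : 1 + (μ - 1) = μ := by omega
    simp only [Finset.sum_range_succ, Finset.sum_range_zero, hasseDeriv_coeff, zero_add, e, h1]
    have : (μ.choose (μ - 1) : ℂ) ≠ 0 := by
      exact_mod_cast (Nat.choose_pos (Nat.sub_le _ _)).ne'
    simp [hμ, hc, this]

/-- One step of the Newton-Puiseux algorithm along the curve `g`, for a root of multiplicity `μ` at
`0` and a family whose term of degree `μ - 1` vanishes identically. -/
theorem HasPuiseuxExpansion.of_normalized {F : ℂ → ℂ[X]} {d μ : ℕ} (hF : AnalyticPolyFamily F d)
    (hμ : 0 < μ) (hlow : ∀ i < μ, (F 0).coeff i = 0) (hμ0 : (F 0).coeff μ ≠ 0)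
    (hpred : ∀ᶠ u in 𝓝 0, (F u).coeff (μ - 1) = 0)
    {g : ℝ → ℂ} (hgc : ∀ᶠ s in 𝓝[>] (0 : ℝ), ContinuousAt g s) (hg0 : Tendsto g (𝓝[>] 0) (𝓝 0))
    (hg : ∀ᶠ s : ℝ in 𝓝[>] (0 : ℝ), (F s).eval (g s) = 0)
    (ih : ∀ (F' : ℂ → ℂ[X]) (d' : ℕ) (g' : ℝ → ℂ) (c : ℂ), AnalyticPolyFamily F' d' → F' 0 ≠ 0 →
      (taylor c (F' 0)).natTrailingDegree < μ → (∀ᶠ s in 𝓝[>] (0 : ℝ), ContinuousAt g' s) →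
      Tendsto g' (𝓝[>] 0) (𝓝 c) → (∀ᶠ s : ℝ in 𝓝[>] (0 : ℝ), (F' s).eval (g' s) = 0) →
      HasPuiseuxExpansion g') :
    HasPuiseuxExpansion g := by
  -- the part of `F` of degree at least `μ` is `z ^ μ` times a function that is nonzero near `0`
  set U : ℝ → ℂ := fun s => ∑ i ∈ Finset.range (d + 1), (F s).coeff (μ + i) * g s ^ i with hU
  have hUlim : Tendsto U (𝓝[>] 0) (𝓝 ((F 0).coeff μ)) := by
    have : Tendsto U (𝓝[>] 0)
        (𝓝 (∑ i ∈ Finset.range (d + 1), (F 0).coeff (μ + i) * 0 ^ i)) :=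
      tendsto_finsetSum _ fun i _ => Tendsto.mul
        ((hF.analyticAt_coeff (μ + i)).continuousAt.tendsto.comp tendsto_ofReal_nhdsGT_zero)
        (hg0.pow i)
    simpa [Finset.sum_range_succ'] using this
  have hsplit : ∀ s : ℝ, (F s).eval (g s)
      = (∑ i ∈ Finset.range μ, (F s).coeff i * g s ^ i) + g s ^ μ * U s := fun s =>
    Polynomial.eval_eq_sum_range_add_pow_mul (hF.natDegree_le s) μ (g s)
  by_cases htriv : ∀ i < μ, analyticOrderAt (fun u => (F u).coeff i) 0 = ⊤
  · -- all lower terms vanish, so `g` vanishes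
    refine ⟨1, one_pos, fun _ => 0, analyticAt_const, ?_⟩
    have hz : ∀ᶠ u in 𝓝 (0 : ℂ), ∀ i ∈ Finset.range μ, (F u).coeff i = 0 :=
      (Finset.eventually_all _).2 fun i hi =>
        analyticOrderAt_eq_top.1 (htriv i (Finset.mem_range.1 hi))
    filter_upwards [hg, tendsto_ofReal_nhdsGT_zero.eventually hz, hUlim.eventually_ne hμ0]
      with s hs hsz hsU
    rw [hsplit, Finset.sum_eq_zero fun i hi => by rw [hsz i hi, zero_mul], zero_add] at hs
    simpa using eq_zero_of_pow_eq_zero ((mul_eq_zero.1 hs).resolve_right hsU)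
  push Not at htriv
  -- the steepest edge of the Newton polygon: the smallest slope `ord a_i / (μ - i)`, at `i₀`
  obtain ⟨i₀, hi₀, hmin⟩ := Finset.exists_min_image
    ((Finset.range μ).filter fun i => analyticOrderAt (fun u => (F u).coeff i) 0 ≠ ⊤)
    (fun i => (analyticOrderNatAt (fun u => (F u).coeff i) 0 : ℚ) / ((μ : ℚ) - i))
    (by obtain ⟨i, hi, h⟩ := htriv; exact ⟨i, by simpa using ⟨hi, h⟩⟩)
  simp only [Finset.mem_filter, Finset.mem_range] at hi₀ hmin
  obtain ⟨hi₀μ, hi₀t⟩ := hi₀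
  set p := analyticOrderNatAt (fun u => (F u).coeff i₀) 0 with hp
  obtain ⟨q, hq⟩ : ∃ q, μ = i₀ + q := ⟨μ - i₀, by omega⟩
  have hq0 : q ≠ 0 := by omega
  have hpcast : analyticOrderAt (fun u => (F u).coeff i₀) 0 = p :=
    (Nat.cast_analyticOrderNatAt hi₀t).symm
  have hp0 : p ≠ 0 := by
    intro h
    rw [h] at hpcast
    exact ((hF.analyticAt_coeff i₀).analyticOrderAt_eq_zero.1 (by simpa using hpcast)) (hlow i₀ hi₀μ)
  have hordcomp : ∀ i, analyticOrderAt (fun v : ℂ => (F (v ^ q)).coeff i) 0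
      = analyticOrderAt (fun u => (F u).coeff i) 0 * q := by
    intro i
    have h0 : (0 : ℂ) ^ q = 0 := zero_pow hq0
    have h1 := AnalyticAt.analyticOrderAt_comp (f := fun u => (F u).coeff i)
      (g := fun v : ℂ => v ^ q) (z₀ := 0) (by simpa [h0] using hF.analyticAt_coeff i) (by fun_prop)
    have h2 := analyticOrderAt_centeredMonomial (𝕜 := ℂ) (z₀ := 0) (n := q)
    simp only [sub_zero, Pi.pow_def] at h2
    simp only [h0, sub_zero, h2] at h1
    exact h1
  have hanal : ∀ i, AnalyticAt ℂ (fun v : ℂ => (F (v ^ q)).coeff i) 0 := by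
    intro i
    exact AnalyticAt.comp (f := fun v : ℂ => v ^ q) (g := fun u => (F u).coeff i)
      (by simpa [zero_pow hq0] using hF.analyticAt_coeff i) (by fun_prop)
  -- the substitution `u = v ^ q`, `z = v ^ p * w` makes `v ^ (p * (μ - i))` divide the coefficients
  have hdiv : ∀ i < μ, ((p * (μ - i) : ℕ) : ℕ∞)
      ≤ analyticOrderAt (fun v : ℂ => (F (v ^ q)).coeff i) 0 := by
    intro i hi
    rw [hordcomp]
    by_cases ht : analyticOrderAt (fun u => (F u).coeff i) 0 = ⊤
    · rw [ht, ENat.top_mul (by exact_mod_cast hq0)]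
      exact le_top
    · rw [← Nat.cast_analyticOrderNatAt ht]
      have h := hmin i ⟨hi, ht⟩
      rw [hq] at h hi ⊢
      have hiq : (0 : ℚ) < ((i₀ + q : ℕ) : ℚ) - i := by
        rw [sub_pos]; exact_mod_cast hi
      have hqq : (0 : ℚ) < q := by positivity
      rw [show (((i₀ + q : ℕ) : ℚ) - i₀) = q by push_cast; ring, div_le_div_iff₀ hqq hiq] at h
      rw [← Nat.cast_mul, Nat.cast_le, ← Nat.cast_le (α := ℚ)]
      push_cast [Nat.cast_sub hi.le]
      push_cast at h
      linarith
  have hb : ∀ i, ∃ b : ℂ → ℂ, AnalyticAt ℂ b 0 ∧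
      (∀ᶠ v in 𝓝 (0 : ℂ), (F (v ^ q)).coeff i * v ^ (p * i) = v ^ (p * μ) * b v) ∧
      (i < μ → (analyticOrderAt (fun v : ℂ => (F (v ^ q)).coeff i) 0 = (p * (μ - i) : ℕ) ↔ b 0 ≠ 0)) ∧
      (i = μ → b 0 = (F 0).coeff μ) ∧ (μ < i → b 0 = 0) := by
    intro i
    rcases lt_or_ge i μ with hi | hi
    · obtain ⟨b, hb1, hb2, hb3⟩ := (hanal i).exists_eq_pow_mul (hdiv i hi)
      refine ⟨b, hb1, ?_, fun _ => hb3, fun h => by omega, fun h => by omega⟩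
      filter_upwards [hb2] with v hv
      have e : p * (μ - i) + p * i = p * μ := by rw [← mul_add, Nat.sub_add_cancel hi.le]
      rw [hv, ← e, pow_add]
      ring
    · refine ⟨fun v => (F (v ^ q)).coeff i * v ^ (p * (i - μ)), (hanal i).mul (by fun_prop),
        Eventually.of_forall fun v => ?_, fun h => by omega, ?_, ?_⟩
      · have e : p * i = p * μ + p * (i - μ) := by rw [← mul_add, Nat.add_sub_of_le hi]
        simp only [e, pow_add]
        ring
      · rintro rfl
        simp [zero_pow hq0]
      · intro h
        have : p * (i - μ) ≠ 0 := Nat.mul_ne_zero hp0 (by omega)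
        simp [zero_pow this]
  choose b hban hbeq hblow hbμ hbhigh using hb
  set N := μ + (d + 1) with hN
  set G : ℂ → ℂ[X] := fun v => ∑ i ∈ Finset.range N, monomial i (b i v) with hG
  have hGcoeff : ∀ v i, (G v).coeff i = if i < N then b i v else 0 := by
    intro v i
    simp [hG, finsetSum_coeff, coeff_monomial]
  have hGfam : AnalyticPolyFamily G N := by
    refine ⟨fun i => ?_, fun v => ?_⟩
    · simp only [hGcoeff]
      split_ifs
      · exact hban i
      · exact analyticAt_const
    · refine natDegree_le_iff_coeff_eq_zero.2 fun i hi => ?_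
      rw [hGcoeff, if_neg (by omega)]
  set w : ℝ → ℂ := fun v => g (v ^ q) / (v : ℂ) ^ p with hw
  have htq := tendsto_pow_nhdsGT_zero hq0
  have hGeval : ∀ᶠ v : ℝ in 𝓝[>] (0 : ℝ), (G v).eval (w v) = 0 := by
    have hall : ∀ᶠ v in 𝓝 (0 : ℂ), ∀ i ∈ Finset.range N,
        (F (v ^ q)).coeff i * v ^ (p * i) = v ^ (p * μ) * b i v :=
      (Finset.eventually_all _).2 fun i _ => hbeq i
    filter_upwards [tendsto_ofReal_nhdsGT_zero.eventually hall, htq.eventually hg,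
      self_mem_nhdsWithin] with v hv hgv hvpos
    have hv0 : (v : ℂ) ≠ 0 := by exact_mod_cast (ne_of_gt (Set.mem_Ioi.1 hvpos))
    have hz : g (v ^ q) = (v : ℂ) ^ p * w v := by
      rw [hw]; field_simp
    have hne : (v : ℂ) ^ (p * μ) ≠ 0 := pow_ne_zero _ hv0
    refine (mul_eq_zero.1 ?_).resolve_left hne
    rw [← hgv, Complex.ofReal_pow, eval_eq_sum_range' (p := F ((v : ℂ) ^ q)) (n := N)
      (by have := hF.natDegree_le ((v : ℂ) ^ q); omega), hz, hG]
    simp only [eval_finsetSum, eval_monomial, Finset.mul_sum]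
    refine Finset.sum_congr rfl fun i hi => ?_
    rw [← mul_assoc, ← hv i hi, mul_pow, ← pow_mul]
    ring
  have hGμ : (G 0).coeff μ ≠ 0 := by
    rw [hGcoeff, if_pos (by omega), hbμ μ rfl]; exact hμ0
  have hG0deg : (G 0).natDegree ≤ μ := by
    refine natDegree_le_iff_coeff_eq_zero.2 fun i hi => ?_
    rw [hGcoeff]
    split_ifs
    · exact hbhigh i hi
    · rfl
  have hGpred : (G 0).coeff (μ - 1) = 0 := by
    rw [hGcoeff, if_pos (by omega)]
    by_contra hne
    have h1 := (hblow (μ - 1) (by omega)).2 hne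
    rw [hordcomp, analyticOrderAt_eq_top.2 hpred, ENat.top_mul (by exact_mod_cast hq0)] at h1
    exact ENat.top_ne_natCast _ h1
  have hGi₀ : (G 0).coeff i₀ ≠ 0 := by
    rw [hGcoeff, if_pos (by omega), ← hblow i₀ hi₀μ, hordcomp, hpcast, hq, Nat.add_sub_cancel_left]
    simp
  have hwcont : ∀ᶠ v in 𝓝[>] (0 : ℝ), ContinuousAt w v := by
    filter_upwards [htq.eventually hgc, self_mem_nhdsWithin] with v hv hvpos
    have hv0 : (v : ℂ) ^ p ≠ 0 :=
      pow_ne_zero _ (by exact_mod_cast (ne_of_gt (Set.mem_Ioi.1 hvpos)))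
    refine ContinuousAt.div (ContinuousAt.comp (f := fun v : ℝ => v ^ q) hv (by fun_prop)) ?_ hv0
    exact (Complex.continuous_ofReal.pow p).continuousAt
  -- the rescaled curve `w` has a limit, a root of `G 0`
  obtain ⟨c, hc, hwc⟩ : ∃ c, (G 0).IsRoot c ∧ Tendsto w (𝓝[>] 0) (𝓝 c) := by
    refine exists_isRoot_tendsto_of_coeff hG0deg hGμ
      (β := fun i v => if i < μ then b i v else U (v ^ q)) ?_ ?_ hwcont
    · intro i hi
      rw [hGcoeff, if_pos (by omega)]
      rcases hi.lt_or_eq with hi | rfl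
      · simp only [if_pos hi]
        exact (hban i).continuousAt.tendsto.comp tendsto_ofReal_nhdsGT_zero
      · simp only [lt_irrefl, if_false]
        rw [hbμ i rfl]
        exact hUlim.comp htq
    · have hall : ∀ᶠ v in 𝓝 (0 : ℂ), ∀ i ∈ Finset.range μ,
          (F (v ^ q)).coeff i * v ^ (p * i) = v ^ (p * μ) * b i v :=
        (Finset.eventually_all _).2 fun i _ => hbeq i
      filter_upwards [tendsto_ofReal_nhdsGT_zero.eventually hall, htq.eventually hg,
        self_mem_nhdsWithin] with v hv hgv hvpos
      have hv0 : (v : ℂ) ≠ 0 := by exact_mod_cast (ne_of_gt (Set.mem_Ioi.1 hvpos))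
      have hz : g (v ^ q) = (v : ℂ) ^ p * w v := by
        rw [hw]; field_simp
      have hne : (v : ℂ) ^ (p * μ) ≠ 0 := pow_ne_zero _ hv0
      refine (mul_eq_zero.1 ?_).resolve_left hne
      rw [hsplit] at hgv
      rw [← hgv, hz, Finset.sum_range_succ, mul_add, Finset.mul_sum]
      simp only [lt_irrefl, if_false, Complex.ofReal_pow]
      congr 1
      · refine Finset.sum_congr rfl fun i hi => ?_
        rw [if_pos (Finset.mem_range.1 hi), ← mul_assoc, ← hv i hi, mul_pow, ← pow_mul]
        ring
      · rw [mul_pow, ← pow_mul]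
        ring
  obtain ⟨m, hm, h, hh, heq⟩ := ih G N w c hGfam (by intro h; simp [h] at hGμ)
    (Polynomial.natTrailingDegree_taylor_lt hG0deg hGμ hGpred hi₀μ hGi₀ c) hwcont hwc hGeval
  refine ⟨m * q, Nat.mul_pos hm (Nat.pos_of_ne_zero hq0), fun v => v ^ (m * p) * h v,
    AnalyticAt.mul (by fun_prop) hh, ?_⟩
  filter_upwards [heq, self_mem_nhdsWithin] with v hv hvpos
  have hv0 : (v : ℂ) ≠ 0 := by exact_mod_cast (ne_of_gt (Set.mem_Ioi.1 hvpos))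
  rw [← hv, hw]
  simp only [Complex.ofReal_pow, ← pow_mul]
  field_simp

/-- The Newton-Puiseux theorem along a real curve: a continuous root of an analytic family of
polynomials, with a limit at the origin, has a Puiseux expansion. -/
theorem hasPuiseuxExpansion_of_root {F : ℂ → ℂ[X]} {d : ℕ} {g : ℝ → ℂ} {c : ℂ}
    (hF : AnalyticPolyFamily F d) (hF0 : F 0 ≠ 0)
    (hgc : ∀ᶠ s in 𝓝[>] (0 : ℝ), ContinuousAt g s) (hg0 : Tendsto g (𝓝[>] 0) (𝓝 c))
    (hg : ∀ᶠ s : ℝ in 𝓝[>] (0 : ℝ), (F s).eval (g s) = 0) : HasPuiseuxExpansion g := by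
  induction hμ : (taylor c (F 0)).natTrailingDegree using Nat.strong_induction_on
    generalizing F d g c with
  | _ μ ih =>
  have hT0 : taylor c (F 0) ≠ 0 := by rwa [Ne, taylor_eq_zero]
  have hroot : (F 0).eval c = 0 := by
    have h1 : Tendsto (fun s : ℝ => (F s).eval (g s)) (𝓝[>] 0) (𝓝 ((F 0).eval c)) :=
      (hF.analyticAt_eval c).continuousAt.tendsto.comp
        (tendsto_ofReal_nhdsGT_zero.prodMk_nhds hg0)
    exact tendsto_nhds_unique h1 (tendsto_const_nhds.congr' (hg.mono fun _ h => h.symm))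
  have hμ0 : (taylor c (F 0)).coeff μ ≠ 0 := by
    rw [← hμ]; exact coeff_natTrailingDegree_ne_zero.2 hT0
  have hlow : ∀ i < μ, (taylor c (F 0)).coeff i = 0 := fun i hi =>
    coeff_eq_zero_of_lt_natTrailingDegree (hμ ▸ hi)
  have hμpos : 0 < μ := by
    rcases Nat.eq_zero_or_pos μ with rfl | h
    · rw [taylor_coeff_zero] at hμ0
      exact absurd hroot hμ0
    · exact h
  -- center the variable at the analytic simple root `φ` of the derivative of order `μ - 1`
  obtain ⟨φ, hφ, hφ0, hφroot⟩ := (hF.hasseDeriv (μ - 1)).exists_analyticAt_root (c := c)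
    (by rw [← taylor_coeff]; exact hlow _ (by omega))
    (by
      have h := LinearMap.congr_fun (hasseDeriv_comp (R := ℂ) 1 (μ - 1)) (F 0)
      rw [hasseDeriv_one, show 1 + (μ - 1) = μ by omega] at h
      simp only [LinearMap.comp_apply, LinearMap.smul_apply] at h
      rw [h, eval_smul, ← taylor_coeff, Nat.choose_one_right, nsmul_eq_mul]
      exact mul_ne_zero (by exact_mod_cast hμpos.ne') hμ0)
  obtain ⟨m, hm, h, hh, heq⟩ := HasPuiseuxExpansion.of_normalized (g := fun s => g s - φ s)
    (hF.taylor hφ) hμpos (by rwa [hφ0]) (by rwa [hφ0])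
    (by simpa only [taylor_coeff] using hφroot)
    (by
      have hφc : ∀ᶠ u in 𝓝 (0 : ℂ), ContinuousAt φ u :=
        hφ.eventually_analyticAt.mono fun u hu => hu.continuousAt
      filter_upwards [hgc, tendsto_ofReal_nhdsGT_zero.eventually hφc] with s h1 h2
      exact h1.sub (ContinuousAt.comp (f := fun s : ℝ => (s : ℂ)) h2
        Complex.continuous_ofReal.continuousAt))
    (by
      have := hg0.sub (hφ.continuousAt.tendsto.comp tendsto_ofReal_nhdsGT_zero)
      simpa [hφ0] using this)
    (by
      filter_upwards [hg] with s hs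
      rw [taylor_eval, sub_add_cancel]
      exact hs)
    (fun F' d' g' c' h1 h2 h3 h4 h5 h6 => ih _ h3 h1 h2 h4 h5 h6 rfl)
  refine ⟨m, hm, fun u => h u + φ (u ^ m), hh.add ?_, ?_⟩
  · exact AnalyticAt.comp (f := fun u : ℂ => u ^ m) (by simpa [zero_pow hm.ne'] using hφ)
      (by fun_prop)
  · filter_upwards [heq] with u hu
    rw [← hu, Complex.ofReal_pow]
    ring

end PuiseuxExpansion

/-! ### Convergent power series and Puiseux series -/

namespace PowerSeries

open Filter Topology

/-- The complex power series that converge absolutely on the closed disk of radius `ρ`. -/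
noncomputable def absConv (ρ : NNReal) : Subalgebra ℂ (PowerSeries ℂ) where
  carrier := {A | Summable fun n => ‖coeff n A * (ρ : ℂ) ^ n‖}
  mul_mem' {A B} hA hB := by
    refine (summable_norm_sum_mul_antidiagonal_of_summable_norm hA hB).congr fun n => ?_
    rw [coeff_mul, Finset.sum_mul]
    congr 1
    refine Finset.sum_congr rfl fun kl hkl => ?_
    rw [← Finset.HasAntidiagonal.mem_antidiagonal.1 hkl, pow_add]
    ring
  add_mem' {A B} hA hB := by
    refine (hA.add hB).of_nonneg_of_le (fun _ => norm_nonneg _) fun n => ?_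
    rw [map_add, add_mul]
    exact norm_add_le _ _
  algebraMap_mem' r := by
    refine summable_of_ne_finset_zero (s := {0}) fun n hn => ?_
    have hn : n ≠ 0 := by simpa using hn
    simp [coeff_C, hn]

theorem mem_absConv {ρ : NNReal} {A : PowerSeries ℂ} :
    A ∈ absConv ρ ↔ Summable fun n => ‖coeff n A * (ρ : ℂ) ^ n‖ := Iff.rfl

theorem absConv_mono {ρ ρ' : NNReal} (h : ρ' ≤ ρ) : absConv ρ ≤ absConv ρ' := by
  intro A hA
  refine Summable.of_nonneg_of_le (fun _ => norm_nonneg _) (fun n => ?_) hA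
  simp only [norm_mul, norm_pow, Complex.norm_real, NNReal.norm_eq]
  gcongr

/-- The sum of a power series at a complex number. Where the series is not summable this is the junk
value `0`; it is only evaluated where the series converges absolutely. -/
noncomputable def sumAt (A : PowerSeries ℂ) (u : ℂ) : ℂ := ∑' n, coeff n A * u ^ n

variable {ρ : NNReal} {A B : PowerSeries ℂ} {u : ℂ}

theorem norm_coeff_mul_pow_le (hu : ‖u‖ ≤ ρ) (A : PowerSeries ℂ) (n : ℕ) :
    ‖coeff n A * u ^ n‖ ≤ ‖coeff n A * (ρ : ℂ) ^ n‖ := by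
  simp only [norm_mul, norm_pow, Complex.norm_real, NNReal.norm_eq]
  gcongr

theorem summable_norm_of_mem_absConv (hA : A ∈ absConv ρ) (hu : ‖u‖ ≤ ρ) :
    Summable fun n => ‖coeff n A * u ^ n‖ :=
  Summable.of_nonneg_of_le (fun _ => norm_nonneg _) (norm_coeff_mul_pow_le hu A) hA

theorem hasSum_sumAt (hA : A ∈ absConv ρ) (hu : ‖u‖ ≤ ρ) :
    HasSum (fun n => coeff n A * u ^ n) (sumAt A u) :=
  (summable_norm_of_mem_absConv hA hu).of_norm.hasSum

theorem sumAt_mul (hA : A ∈ absConv ρ) (hB : B ∈ absConv ρ) (hu : ‖u‖ ≤ ρ) :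
    sumAt (A * B) u = sumAt A u * sumAt B u := by
  rw [sumAt, sumAt, sumAt, tsum_mul_tsum_eq_tsum_sum_antidiagonal_of_summable_norm
    (summable_norm_of_mem_absConv hA hu) (summable_norm_of_mem_absConv hB hu)]
  refine tsum_congr fun n => ?_
  rw [coeff_mul, Finset.sum_mul]
  refine Finset.sum_congr rfl fun kl hkl => ?_
  rw [← Finset.HasAntidiagonal.mem_antidiagonal.1 hkl, pow_add]
  ring

theorem sumAt_C (c u : ℂ) : sumAt (C c) u = c := by
  rw [sumAt, tsum_eq_single 0 fun n hn => by simp [coeff_C, hn]]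
  simp

theorem sumAt_monomial (m : ℕ) (c u : ℂ) : sumAt (monomial m c) u = c * u ^ m := by
  rw [sumAt, tsum_eq_single m fun n hn => by simp [coeff_monomial, hn]]
  simp

/-- Summation at a point of the disk of convergence, as an algebra homomorphism. -/
noncomputable def sumAtHom (hu : ‖u‖ ≤ ρ) : absConv ρ →ₐ[ℂ] ℂ where
  toFun A := sumAt A u
  map_one' := by simpa using sumAt_C 1 u
  map_mul' A B := sumAt_mul A.2 B.2 hu
  map_zero' := by simpa using sumAt_C 0 u
  map_add' A B := ((hasSum_sumAt A.2 hu).add (hasSum_sumAt B.2 hu)).tsum_eq ▸ by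
    simp [sumAt, add_mul]
  commutes' r := sumAt_C r u

section aeval

variable {σ : Type*} {Y : σ → PowerSeries ℂ}

theorem aeval_mem_absConv (hY : ∀ k, Y k ∈ absConv ρ) (f : MvPolynomial σ ℂ) :
    MvPolynomial.aeval Y f ∈ absConv ρ := by
  have h := MvPolynomial.comp_aeval_apply (fun k => (⟨Y k, hY k⟩ : absConv ρ)) (absConv ρ).val f
  simp only [Subalgebra.coe_val] at h
  exact h ▸ Subtype.property _

theorem sumAt_aeval (hY : ∀ k, Y k ∈ absConv ρ) (f : MvPolynomial σ ℂ) (hu : ‖u‖ ≤ ρ) :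
    sumAt (MvPolynomial.aeval Y f) u = MvPolynomial.aeval (fun k => sumAt (Y k) u) f := by
  have h1 := MvPolynomial.comp_aeval_apply (fun k => (⟨Y k, hY k⟩ : absConv ρ)) (absConv ρ).val f
  have h2 := MvPolynomial.comp_aeval_apply (fun k => (⟨Y k, hY k⟩ : absConv ρ)) (sumAtHom hu) f
  simp only [Subalgebra.coe_val] at h1
  rw [← h1]
  exact h2

end aeval

theorem continuousOn_sumAt (hA : A ∈ absConv ρ) :
    ContinuousOn (sumAt A) (Metric.closedBall 0 ρ) :=
  continuousOn_tsum (fun n => by fun_prop) hA fun n u hu =>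
    norm_coeff_mul_pow_le (by simpa using hu) A n

theorem hasFPowerSeriesAt_sumAt (hρ : 0 < ρ) (hA : A ∈ absConv ρ) :
    HasFPowerSeriesAt (sumAt A) (FormalMultilinearSeries.ofScalars ℂ fun n => coeff n A) 0 := by
  rw [hasFPowerSeriesAt_iff]
  filter_upwards [Metric.closedBall_mem_nhds (0 : ℂ) (NNReal.coe_pos.2 hρ)] with u hu
  simpa [FormalMultilinearSeries.coeff_ofScalars, mul_comm] using
    hasSum_sumAt hA (by simpa using hu)

/-- The identity theorem: a convergent power series whose sum vanishes for all small positive reals is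
zero. -/
theorem eq_zero_of_sumAt_eq_zero (hρ : 0 < ρ) (hA : A ∈ absConv ρ)
    (h : ∀ᶠ u : ℝ in 𝓝[>] 0, sumAt A u = 0) : A = 0 := by
  have hp := hasFPowerSeriesAt_sumAt hρ hA
  have hfreq : ∃ᶠ z in 𝓝[≠] (0 : ℂ), sumAt A z = 0 := by
    have ht : Tendsto (fun s : ℝ => (s : ℂ)) (𝓝[>] 0) (𝓝[≠] 0) := by
      refine tendsto_nhdsWithin_iff.2 ⟨tendsto_ofReal_nhdsGT_zero, ?_⟩
      filter_upwards [self_mem_nhdsWithin] with s hs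
      simpa using (ne_of_gt (Set.mem_Ioi.1 hs))
    exact ht.frequently h.frequently
  have hz := hp.analyticAt.frequently_zero_iff_eventually_zero.1 hfreq
  have h0 : HasFPowerSeriesAt (0 : ℂ → ℂ)
      (FormalMultilinearSeries.ofScalars ℂ fun n => coeff n A) 0 := hp.congr hz
  have := h0.eq_zero
  ext n
  have hn := congrArg (fun p => FormalMultilinearSeries.coeff p n) this
  rw [FormalMultilinearSeries.coeff_ofScalars] at hn
  exact hn

/-- An analytic function is the sum of a convergent power series. -/
theorem exists_sumAt_eq_of_analyticAt {h : ℂ → ℂ} (hh : AnalyticAt ℂ h 0) :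
    ∃ A : PowerSeries ℂ, ∃ ρ : NNReal, 0 < ρ ∧ A ∈ absConv ρ ∧ ∀ u : ℂ, ‖u‖ ≤ ρ → sumAt A u = h u := by
  obtain ⟨p, hp⟩ := hh
  rw [hasFPowerSeriesAt_iff] at hp
  obtain ⟨r, hr, hball⟩ := Metric.nhds_basis_closedBall.eventually_iff.1 hp
  have hsum : ∀ u : ℂ, ‖u‖ ≤ r → HasSum (fun n => coeff n (mk p.coeff) * u ^ n) (h u) := by
    intro u hu
    simpa [mul_comm] using hball (show u ∈ Metric.closedBall 0 r by simpa using hu)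
  refine ⟨mk p.coeff, ⟨r, hr.le⟩, hr, ?_, fun u hu => (hsum u hu).tsum_eq⟩
  exact (hsum (r : ℂ) (by simp [abs_of_pos hr])).summable.norm

/-- Substitution of `t ^ (1 / m)` for the variable: a power series becomes a Puiseux series. -/
noncomputable def toPuiseux (m : ℕ) (hm : 0 < m) : PowerSeries ℂ →+* HahnSeries ℚ ℂ :=
  (HahnSeries.embDomainRingHom
    (AddMonoidHom.mk' (fun n : ℕ => (n : ℚ) / m) fun a b => by push_cast; ring)
    (fun a b h => by
      have : (m : ℚ) ≠ 0 := by positivity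
      simpa [div_left_inj' this] using h)
    (fun a b => by
      have : (0 : ℚ) < m := by positivity
      simp [div_le_div_iff_of_pos_right this])).comp
  HahnSeries.toPowerSeries.symm.toRingHom

variable {m : ℕ} (hm : 0 < m)

theorem div_natCast_injective (hm : 0 < m) : Function.Injective fun n : ℕ => (n : ℚ) / m :=
  fun a b h => by
    have : (m : ℚ) ≠ 0 := by positivity
    simpa [div_left_inj' this] using h

theorem coeff_toPuiseux (A : PowerSeries ℂ) (n : ℕ) :
    (toPuiseux m hm A).coeff ((n : ℚ) / m) = coeff n A :=
  HahnSeries.embDomain_mk_coeff (f := fun n : ℕ => (n : ℚ) / m) _ _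

theorem coeff_toPuiseux_of_notMem {q : ℚ} (A : PowerSeries ℂ)
    (hq : q ∉ Set.range fun n : ℕ => (n : ℚ) / m) : (toPuiseux m hm A).coeff q = 0 :=
  HahnSeries.embDomain_of_notMem_range hq

theorem exists_of_mem_support_toPuiseux {A : PowerSeries ℂ} {q : ℚ}
    (hq : q ∈ (toPuiseux m hm A).support) : ∃ n : ℕ, (n : ℚ) / m = q ∧ coeff n A ≠ 0 := by
  have hr : q ∈ Set.range fun n : ℕ => (n : ℚ) / m := by
    by_contra h
    exact hq (coeff_toPuiseux_of_notMem hm A h)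
  obtain ⟨n, rfl⟩ := hr
  exact ⟨n, rfl, by rwa [HahnSeries.mem_support, coeff_toPuiseux] at hq⟩

theorem isPuiseux_toPuiseux (A : PowerSeries ℂ) : IsPuiseux (toPuiseux m hm A) := by
  refine ⟨m, hm, fun q hq => ?_⟩
  obtain ⟨n, rfl, _⟩ := exists_of_mem_support_toPuiseux hm hq
  exact ⟨n, by simp⟩

theorem orderTop_toPuiseux {A : PowerSeries ℂ} {a : ℕ} (ha : IsLeast {n | coeff n A ≠ 0} a) :
    (toPuiseux m hm A).orderTop = (((a : ℚ) / m : ℚ) : WithTop ℚ) := by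
  refine HahnSeries.orderTop_eq_of_le (by simpa [coeff_toPuiseux] using ha.1) fun q hq => ?_
  obtain ⟨n, rfl, hn⟩ := exists_of_mem_support_toPuiseux hm hq
  have := ha.2 hn
  gcongr

theorem orderTop_toPuiseux_nonneg (A : PowerSeries ℂ) : 0 ≤ (toPuiseux m hm A).orderTop := by
  by_cases hA : A = 0
  · simp [hA]
  · classical
    have hex : ∃ n, coeff n A ≠ 0 := by
      by_contra! h
      exact hA (ext (by simpa using h))
    rw [orderTop_toPuiseux hm ⟨Nat.find_spec hex, fun n hn => Nat.find_min' hex hn⟩]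
    have : (0 : ℚ) ≤ (Nat.find hex : ℚ) / m := by positivity
    exact_mod_cast this

theorem toPuiseux_C (c : ℂ) : toPuiseux m hm (C c) = HahnSeries.C c := by
  ext q
  rw [HahnSeries.C_apply, HahnSeries.coeff_single]
  by_cases hq : q ∈ Set.range fun n : ℕ => (n : ℚ) / m
  · obtain ⟨n, rfl⟩ := hq
    have : (m : ℚ) ≠ 0 := by positivity
    simp [coeff_toPuiseux, coeff_C, this]
  · rw [coeff_toPuiseux_of_notMem hm _ hq, if_neg]
    rintro rfl
    exact hq ⟨0, by simp⟩

theorem toPuiseux_X_pow : toPuiseux m hm (X ^ m : PowerSeries ℂ) = HahnSeries.single 1 1 := by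
  have h0 : (m : ℚ) ≠ 0 := by positivity
  ext q
  rw [HahnSeries.coeff_single]
  by_cases hq : q ∈ Set.range fun n : ℕ => (n : ℚ) / m
  · obtain ⟨n, rfl⟩ := hq
    rw [coeff_toPuiseux]
    simp [coeff_X_pow, div_eq_one_iff_eq h0]
  · rw [coeff_toPuiseux_of_notMem hm _ hq, if_neg]
    rintro rfl
    exact hq ⟨m, by simp [h0]⟩

theorem aeval_toPuiseux {σ : Type*} (Y : σ → PowerSeries ℂ) (f : MvPolynomial σ ℂ) :
    MvPolynomial.aeval (fun k => toPuiseux m hm (Y k)) f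
      = toPuiseux m hm (MvPolynomial.aeval Y f) := by
  induction f using MvPolynomial.induction_on with
  | C c =>
    rw [MvPolynomial.aeval_C, MvPolynomial.aeval_C, HahnSeries.algebraMap_apply']
    simp only [algebraMap_apply, Algebra.algebraMap_self, RingHom.id_apply, HahnSeries.ofPowerSeries_C,
      toPuiseux_C]
  | add p q hp hq => simp only [map_add, hp, hq]
  | mul_X p k hp => simp only [map_mul, hp, MvPolynomial.aeval_X]

theorem rpow_natCast_div {s : ℝ} (hs : 0 ≤ s) (n m : ℕ) :
    s ^ (((n : ℚ) / m : ℚ) : ℝ) = (s ^ (1 / (m : ℝ))) ^ n := by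
  rw [← Real.rpow_natCast, ← Real.rpow_mul hs]
  congr 1
  push_cast
  ring

theorem hasValueAt_toPuiseux_iff {A : PowerSeries ℂ} {s : ℝ} (hs : 0 ≤ s) (v : ℂ) :
    PuiseuxHasValueAt (toPuiseux m hm A) s v ↔
      HasSum (fun n => coeff n A * ((s ^ (1 / (m : ℝ)) : ℝ) : ℂ) ^ n) v := by
  rw [PuiseuxHasValueAt, ← (div_natCast_injective hm).hasSum_iff fun q hq => by
    rw [coeff_toPuiseux_of_notMem hm A hq, zero_mul]]
  refine iff_of_eq (congrArg (HasSum · v) (funext fun n => ?_))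
  simp only [Function.comp_apply, coeff_toPuiseux, rpow_natCast_div hs, Complex.ofReal_pow]

theorem convergesAt_toPuiseux_iff {A : PowerSeries ℂ} {s : ℝ} (hs : 0 ≤ s) :
    PuiseuxConvergesAt (toPuiseux m hm A) s ↔
      Summable (fun n => coeff n A * ((s ^ (1 / (m : ℝ)) : ℝ) : ℂ) ^ n) :=
  exists_congr fun v => hasValueAt_toPuiseux_iff hm hs v

end PowerSeries

/-! ### Expansion of the tracked path at the origin -/

section Relation

open Polynomial Polynomial.Bivariate

theorem trdeg_bivariate : Algebra.trdeg ℂ ℂ[X][Y] = 2 := by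
  rw [(Polynomial.Bivariate.equivMvPolynomial ℂ).trdeg_eq]
  simp

variable {n : ℕ} {X : Set (Fin (n + 1) → ℂ)}

theorem aevalAeval_X_mem_vanishingIdeal_iff (j k : Fin (n + 1)) (G : ℂ[X][Y]) :
    aevalAeval (MvPolynomial.X j : MvPolynomial (Fin (n + 1)) ℂ) (MvPolynomial.X k) G
      ∈ MvPolynomial.vanishingIdeal ℂ X ↔ ∀ x ∈ X, G.evalEval (x j) (x k) = 0 := by
  rw [MvPolynomial.mem_vanishingIdeal_iff]
  refine forall₂_congr fun x _ => ?_
  rw [← coe_aevalAeval_eq_evalEval]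
  have : (MvPolynomial.aeval x).comp
      (aevalAeval (MvPolynomial.X j : MvPolynomial (Fin (n + 1)) ℂ) (MvPolynomial.X k))
      = aevalAeval (x j) (x k) := by
    ext <;> simp
  rw [← this]
  rfl

/-- Any two coordinates on a curve satisfy an algebraic relation. If the second coordinate does not
vanish identically, the relation can be chosen not divisible by it. -/
theorem IsIrreducibleCurve.exists_relation (hX : IsIrreducibleCurve X) (j k : Fin (n + 1))
    (hk : ∃ x ∈ X, x k ≠ 0) :
    ∃ G : ℂ[X][Y], G.coeff 0 ≠ 0 ∧ ∀ x ∈ X, G.evalEval (x j) (x k) = 0 := by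
  have hprime := hX.prime
  set I := MvPolynomial.vanishingIdeal ℂ X with hI
  set ψ := aevalAeval (R := ℂ) (MvPolynomial.X j : MvPolynomial (Fin (n + 1)) ℂ)
    (MvPolynomial.X k)
  obtain ⟨G, hG0, hG⟩ : ∃ G : ℂ[X][Y], G ≠ 0 ∧ ψ G ∈ I := by
    by_contra! hcon
    have hinj : Function.Injective ((Ideal.Quotient.mkₐ ℂ I).comp ψ) := by
      rw [injective_iff_map_eq_zero]
      intro G hG
      by_contra hne
      exact hcon G hne (Ideal.Quotient.eq_zero_iff_mem.1 hG)
    have h := trdeg_le_of_injective _ hinj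
    rw [hX.dim_one, trdeg_bivariate] at h
    norm_num at h
  obtain ⟨H, hH, hmul⟩ := exists_eq_pow_rootMultiplicity_mul_and_not_dvd G hG0 0
  rw [C_0, sub_zero] at hH hmul
  refine ⟨H, fun h => hmul (X_dvd_iff.2 h), ?_⟩
  rw [← aevalAeval_X_mem_vanishingIdeal_iff]
  rw [hH, map_mul, map_pow] at hG
  refine (hprime.mem_or_mem hG).resolve_left fun h => ?_
  have h1 := hprime.mem_of_pow_mem _ h
  rw [aevalAeval_Y, hI, MvPolynomial.mem_vanishingIdeal_iff] at h1
  obtain ⟨x, hx, hxk⟩ := hk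
  exact hxk (by simpa using h1 x hx)

end Relation

section PathExpansion

open Polynomial Polynomial.Bivariate Filter Topology

/-- A nonzero bivariate polynomial is a power of the first variable times a polynomial that stays
nonzero when the first variable is set to zero. -/
theorem Polynomial.exists_eq_C_X_pow_mul {G : ℂ[X][Y]} (hG : G ≠ 0) :
    ∃ (a : ℕ) (H : ℂ[X][Y]), G = C (X ^ a) * H ∧ H.map (evalRingHom 0) ≠ 0 := by
  have hu : ¬IsUnit (C X : ℂ[X][Y]) := by
    rw [isUnit_C]
    exact not_isUnit_X
  obtain ⟨a, H, hH, hmul⟩ := WfDvdMonoid.max_power_factor hG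
    (irreducible_iff_prime.2 (prime_C_iff.2 prime_X) : Irreducible (C X : ℂ[X][Y]))
  refine ⟨a, H, by rw [hmul, C_pow], fun h => hH ?_⟩
  rw [C_dvd_iff_dvd_coeff]
  intro i
  rw [X_dvd_iff, coeff_zero_eq_eval_zero]
  simpa using congrArg (fun q => q.coeff i) h

variable {n : ℕ} {X : Set (Fin (n + 1) → ℂ)} {j : Fin (n + 1)} {τ : ℂ} {p : Fin (n + 1) → ℂ}
  {P : ℝ → Fin (n + 1) → ℂ}

theorem IsTrackedPath.tendsto (hP : IsTrackedPath X j τ p P) : Tendsto P (𝓝[>] 0) (𝓝 (P 0)) := by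
  have h := hP.continuousOn 0 (by simp)
  refine h.tendsto.mono_left ?_
  rw [← nhdsWithin_Ioo_eq_nhdsGT (zero_lt_one (α := ℝ))]
  exact nhdsWithin_mono _ Set.Ioo_subset_Icc_self

theorem eventually_mem_Ioo_zero_one : ∀ᶠ s : ℝ in 𝓝[>] 0, s ∈ Set.Ioo (0 : ℝ) 1 :=
  Ioo_mem_nhdsGT zero_lt_one

theorem IsTrackedPath.hasPuiseuxExpansion (hX : IsIrreducibleCurve X)
    (hcoord : ∀ k, ∃ x ∈ X, x k ≠ 0) (hτ : τ ≠ 0) (hP : IsTrackedPath X j τ p P) (k : Fin (n + 1)) :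
    HasPuiseuxExpansion fun s => P s k := by
  obtain ⟨G, hG0, hG⟩ := hX.exists_relation j k (hcoord k)
  obtain ⟨a, H, hGH, hH0⟩ := Polynomial.exists_eq_C_X_pow_mul (G := G)
    (by rintro rfl; simp at hG0)
  have hfam : AnalyticPolyFamily (fun u => H.map (evalRingHom (τ * u))) H.natDegree := by
    refine ⟨fun i => ?_, fun u => natDegree_map_le⟩
    simp only [coeff_map, coe_evalRingHom]
    exact AnalyticAt.aeval_polynomial (by fun_prop) (H.coeff i)
  refine hasPuiseuxExpansion_of_root (c := P 0 k) hfam (by simpa using hH0) ?_ ?_ ?_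
  · filter_upwards [eventually_mem_Ioo_zero_one] with s hs
    exact (continuous_apply k).continuousAt.comp
      (hP.continuousOn.continuousAt (Icc_mem_nhds hs.1 hs.2))
  · exact (continuous_apply k).continuousAt.tendsto.comp hP.tendsto
  · filter_upwards [eventually_mem_Ioo_zero_one] with s hs
    have hs' := Set.Ioo_subset_Icc_self hs
    have h := hG (P s) (hP.mem s hs')
    rw [hGH, evalEval_mul, evalEval_C, hP.coord s hs'] at h
    rw [map_evalRingHom_eval]
    refine (mul_eq_zero.1 h).resolve_left ?_
    have : (s : ℂ) ≠ 0 := by exact_mod_cast hs.1.ne'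
    simp [hτ, this]

/-- The coordinates of the tracked path are given near `s = 0` by convergent power series in a common
root of `s`. -/
theorem IsTrackedPath.exists_powerSeries (hX : IsIrreducibleCurve X)
    (hcoord : ∀ k, ∃ x ∈ X, x k ≠ 0) (hτ : τ ≠ 0) (hP : IsTrackedPath X j τ p P) :
    ∃ (m : ℕ) (_ : 0 < m) (ρ : NNReal) (_ : 0 < ρ) (A : Fin (n + 1) → PowerSeries ℂ),
      (∀ k, A k ∈ PowerSeries.absConv ρ) ∧
      ∀ᶠ u : ℝ in 𝓝[>] 0, ∀ k, P (u ^ m) k = PowerSeries.sumAt (A k) u := by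
  choose m hm h hh heq using hP.hasPuiseuxExpansion hX hcoord hτ
  -- a common multiple of the ramification indices of the coordinates
  set M := ∏ k, m k with hM
  have hMpos : 0 < M := Finset.prod_pos fun k _ => hm k
  have hdvd : ∀ k, m k ∣ M := fun k => Finset.dvd_prod_of_mem m (Finset.mem_univ k)
  have hquot : ∀ k, M / m k ≠ 0 := fun k =>
    (Nat.div_pos (Nat.le_of_dvd hMpos (hdvd k)) (hm k)).ne'
  have hser : ∀ k, ∃ A : PowerSeries ℂ, ∃ ρ : NNReal, 0 < ρ ∧ A ∈ PowerSeries.absConv ρ ∧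
      ∀ u : ℂ, ‖u‖ ≤ ρ → PowerSeries.sumAt A u = h k (u ^ (M / m k)) := by
    intro k
    refine PowerSeries.exists_sumAt_eq_of_analyticAt (h := fun u => h k (u ^ (M / m k))) ?_
    exact AnalyticAt.comp (f := fun u : ℂ => u ^ (M / m k)) (by simpa [hquot k] using hh k)
      (by fun_prop)
  choose A ρ hρ hA hsum using hser
  set r := Finset.univ.inf' Finset.univ_nonempty ρ with hr
  have hrpos : 0 < r := (Finset.lt_inf'_iff _).2 fun k _ => hρ k
  have hrle : ∀ k, r ≤ ρ k := fun k => Finset.inf'_le _ (Finset.mem_univ k)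
  refine ⟨M, hMpos, r, hrpos, A, fun k => PowerSeries.absConv_mono (hrle k) (hA k), ?_⟩
  rw [Filter.eventually_all]
  intro k
  have hsmall : ∀ᶠ u : ℝ in 𝓝[>] 0, u ∈ Set.Ioo (0 : ℝ) (ρ k) :=
    Ioo_mem_nhdsGT (NNReal.coe_pos.2 (hρ k))
  filter_upwards [(tendsto_pow_nhdsGT_zero (hquot k)).eventually (heq k), hsmall] with u hu hus
  rw [hsum k u (by simpa [abs_of_pos hus.1] using hus.2.le), ← Complex.ofReal_pow, ← hu, ← pow_mul,
    Nat.div_mul_cancel (hdvd k)]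

end PathExpansion

/-! ### Convergence on the unit disk -/

section Zone

open Filter Topology

variable {n : ℕ} {X : Set (Fin (n + 1) → ℂ)} {j : Fin (n + 1)} {τ : ℂ} {p : Fin (n + 1) → ℂ}
  {P : ℝ → Fin (n + 1) → ℂ}

theorem PowerSeries.aeval_rescale {σ : Type*} (Y : σ → PowerSeries ℂ) (a : ℂ)
    (f : MvPolynomial σ ℂ) :
    MvPolynomial.aeval (fun k => PowerSeries.rescale a (Y k)) f
      = PowerSeries.rescale a (MvPolynomial.aeval Y f) := by
  induction f using MvPolynomial.induction_on with
  | C c =>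
    ext i
    rcases eq_or_ne i 0 with rfl | hi
    · simp
    · simp [PowerSeries.coeff_C, hi]
  | add p q hp hq => simp only [map_add, hp, hq]
  | mul_X p k hp => simp only [map_mul, hp, MvPolynomial.aeval_X]

/-- A tuple `A` of power series, absolutely convergent on the closed unit disk, that parametrizes part of
`X` by a coordinate `u` with `x_j = τ u ^ m`. -/
structure IsDiskParametrization (X : Set (Fin (n + 1) → ℂ)) (j : Fin (n + 1)) (τ : ℂ) (m : ℕ)
    (A : Fin (n + 1) → PowerSeries ℂ) : Prop where
  pos : 0 < m
  absConv : ∀ k, A k ∈ PowerSeries.absConv 1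
  aeval_eq_zero : ∀ f ∈ MvPolynomial.vanishingIdeal ℂ X, MvPolynomial.aeval A f = 0
  coord : A j = PowerSeries.monomial m τ

/-- Inside the endgame operating zone the path is given near `s = 0` by power series in `s ^ (1 / m)`
that converge absolutely on the closed unit disk. After the substitution `t = τ s` they form a branch of
`X` at `x_j = 0`, to which the convergence hypothesis applies. -/
theorem IsTrackedPath.exists_isDiskParametrization (hX : IsIrreducibleCurve X)
    (hcoord : ∀ k, ∃ x ∈ X, x k ≠ 0) (hτ : τ ≠ 0) (hzone : InEndgameZone X j τ)
    (hP : IsTrackedPath X j τ p P) :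
    ∃ (m : ℕ) (A : Fin (n + 1) → PowerSeries ℂ), IsDiskParametrization X j τ m A ∧
      ∀ᶠ u : ℝ in 𝓝[>] 0, ∀ k, P (u ^ m) k = PowerSeries.sumAt (A k) u := by
  obtain ⟨m, hm, ρ, hρ, A, hA, hPA⟩ := hP.exists_powerSeries hX hcoord hτ
  have hsmall : ∀ᶠ u : ℝ in 𝓝[>] 0, u ^ m ∈ Set.Ioo (0 : ℝ) 1 :=
    (tendsto_pow_nhdsGT_zero hm.ne').eventually eventually_mem_Ioo_zero_one
  have hρsmall : ∀ᶠ u : ℝ in 𝓝[>] 0, ‖(u : ℂ)‖ ≤ ρ := by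
    filter_upwards [Ioo_mem_nhdsGT (NNReal.coe_pos.2 hρ)] with u hu
    simpa [abs_of_pos hu.1] using hu.2.le
  have hvan : ∀ f ∈ MvPolynomial.vanishingIdeal ℂ X, MvPolynomial.aeval A f = 0 := by
    intro f hf
    refine PowerSeries.eq_zero_of_sumAt_eq_zero hρ (PowerSeries.aeval_mem_absConv hA f) ?_
    filter_upwards [hPA, hsmall, hρsmall] with u hu hu1 huρ
    rw [PowerSeries.sumAt_aeval hA f huρ]
    have : (fun k => PowerSeries.sumAt (A k) u) = P (u ^ m) := funext fun k => (hu k).symm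
    rw [this]
    exact hf _ (hP.mem _ (Set.Ioo_subset_Icc_self hu1))
  have hmono : PowerSeries.monomial m τ ∈ PowerSeries.absConv ρ := by
    refine summable_of_ne_finset_zero (s := {m}) fun i hi => ?_
    have hi : i ≠ m := by simpa using hi
    simp [PowerSeries.coeff_monomial, hi]
  have hAj : A j = PowerSeries.monomial m τ := by
    refine sub_eq_zero.1 (PowerSeries.eq_zero_of_sumAt_eq_zero hρ (sub_mem (hA j) hmono) ?_)
    filter_upwards [hPA, hsmall, hρsmall] with u hu hu1 huρ
    have h := map_sub (PowerSeries.sumAtHom huρ) ⟨A j, hA j⟩ ⟨_, hmono⟩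
    refine h.trans ?_
    change PowerSeries.sumAt (A j) u - PowerSeries.sumAt (PowerSeries.monomial m τ) u = 0
    rw [← hu j, hP.coord _ (Set.Ioo_subset_Icc_self hu1), PowerSeries.sumAt_monomial,
      Complex.ofReal_pow, sub_self]
  refine ⟨m, A, ⟨hm, fun k => ?_, hvan, hAj⟩, hPA⟩
  -- an `m`-th root `σ` of `τ`: the parameter `σ u` is an `m`-th root of `t = τ s`
  obtain ⟨σ, hσ⟩ := IsAlgClosed.exists_pow_nat_eq τ hm
  have hσ0 : σ ≠ 0 := by
    rintro rfl
    rw [zero_pow hm.ne'] at hσ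
    exact hτ hσ.symm
  have hσn : 0 < ‖σ‖ := norm_pos_iff.2 hσ0
  have hroot : ∀ r : ℝ, 0 ≤ r → (r ^ m) ^ (1 / (m : ℝ)) = r := fun r hr => by
    rw [one_div]; exact Real.pow_rpow_inv_natCast hr hm.ne'
  -- rescaling by `σ⁻¹` turns convergence at `u = r` into convergence at `r ‖σ‖`
  have hnorm : ∀ (r : ℝ) (k : Fin (n + 1)) (i : ℕ),
      ‖PowerSeries.coeff i (PowerSeries.rescale σ⁻¹ (A k)) * ((r * ‖σ‖ : ℝ) : ℂ) ^ i‖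
        = ‖PowerSeries.coeff i (A k) * (r : ℂ) ^ i‖ := by
    intro r k i
    simp only [PowerSeries.coeff_rescale, norm_mul, norm_pow, norm_inv, inv_pow, Complex.norm_real,
      norm_norm, mul_pow]
    have : ‖σ‖ ^ i ≠ 0 := by positivity
    field_simp
  have hbranch : IsBranchAtZero X j
      fun k => PowerSeries.toPuiseux m hm (PowerSeries.rescale σ⁻¹ (A k)) := by
    refine ⟨fun k => PowerSeries.isPuiseux_toPuiseux hm _,
      fun k => PowerSeries.orderTop_toPuiseux_nonneg hm _,
      ⟨(ρ * ‖σ‖) ^ m, by positivity, fun k => ?_⟩, ?_, ?_⟩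
    · rw [PowerSeries.convergesAt_toPuiseux_iff hm (by positivity), hroot _ (by positivity)]
      exact Summable.of_norm ((hA k).congr fun i => (hnorm ρ k i).symm)
    · intro f hf
      rw [PowerSeries.aeval_toPuiseux, PowerSeries.aeval_rescale, hvan f hf, map_zero, map_zero]
    · simp only [hAj]
      rw [← PowerSeries.toPuiseux_X_pow hm]
      congr 1
      ext i
      rw [PowerSeries.coeff_rescale, PowerSeries.coeff_monomial, PowerSeries.coeff_X_pow]
      split_ifs with hi
      · rw [hi, ← hσ, ← mul_pow, inv_mul_cancel₀ hσ0, one_pow]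
      · rw [mul_zero]
  have hconv := hzone.convergent _ hbranch k
  rw [← hσ, norm_pow, PowerSeries.convergesAt_toPuiseux_iff hm (by positivity),
    hroot _ (norm_nonneg _)] at hconv
  refine (summable_norm_iff.2 hconv).congr fun i => ?_
  simpa using hnorm 1 k i

end Zone

/-! ### Uniqueness of lifts -/

section Lifting

open Filter Topology

variable {n : ℕ} {X : Set (Fin (n + 1) → ℂ)} {j : Fin (n + 1)} {τ : ℂ}

theorem MvPolynomial.hasStrictFDerivAt_eval {N : ℕ} (f : MvPolynomial (Fin N) ℂ) (x : Fin N → ℂ) :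
    HasStrictFDerivAt (fun z => MvPolynomial.eval z f)
      (∑ i, MvPolynomial.eval x (MvPolynomial.pderiv i f) •
        (ContinuousLinearMap.proj i : (Fin N → ℂ) →L[ℂ] ℂ)) x := by
  induction f using MvPolynomial.induction_on with
  | C c =>
    refine ((hasStrictFDerivAt_const (𝕜 := ℂ) c x).congr_fderiv ?_).congr_of_eventuallyEq
      (Eventually.of_forall fun z => by simp)
    ext v
    simp
  | add p q hp hq =>
    refine ((hp.add hq).congr_fderiv ?_).congr_of_eventuallyEq (Eventually.of_forall fun z => by simp)
    ext v
    simp [add_mul, Finset.sum_add_distrib]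
  | mul_X p i hp =>
    refine ((hp.mul (ContinuousLinearMap.proj (R := ℂ) (φ := fun _ : Fin N => ℂ)
      i).hasStrictFDerivAt).congr_fderiv ?_).congr_of_eventuallyEq
      (Eventually.of_forall fun z => by simp)
    ext v
    simp [MvPolynomial.pderiv_X, Pi.single_apply, add_mul, Finset.sum_add_distrib, Finset.mul_sum,
      apply_ite (MvPolynomial.eval x), mul_assoc]

/-- Near a noncritical point, points of `X` are determined by their `j`-th coordinate: a limit of
normalized secants with vanishing `j`-th component would be a null vector of the Jacobian matrix. -/
theorem exists_nhds_injOn_coord {x : Fin (n + 1) → ℂ} (hx : x ∈ X) (hcrit : ¬IsCriticalPoint X j x) :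
    ∃ U ∈ 𝓝 x, ∀ a ∈ X ∩ U, ∀ b ∈ X ∩ U, a j = b j → a = b := by
  by_contra! hcon
  have hball : ∀ i : ℕ, ∃ a b, a ∈ X ∧ b ∈ X ∧ dist a x < 1 / (i + 1) ∧ dist b x < 1 / (i + 1) ∧
      a j = b j ∧ a ≠ b := by
    intro i
    obtain ⟨a, ha, b, hb, hab, hne⟩ :=
      hcon (Metric.ball x (1 / (i + 1))) (Metric.ball_mem_nhds x (by positivity))
    exact ⟨a, b, ha.1, hb.1, ha.2, hb.2, hab, hne⟩
  choose a b ha hb hax hbx hab hne using hball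
  have hlim : Tendsto (fun i : ℕ => (1 : ℝ) / (i + 1)) atTop (𝓝 0) :=
    tendsto_one_div_add_atTop_nhds_zero_nat
  have hax' : Tendsto a atTop (𝓝 x) := tendsto_iff_dist_tendsto_zero.2
    (squeeze_zero (fun _ => dist_nonneg) (fun i => (hax i).le) hlim)
  have hbx' : Tendsto b atTop (𝓝 x) := tendsto_iff_dist_tendsto_zero.2
    (squeeze_zero (fun _ => dist_nonneg) (fun i => (hbx i).le) hlim)
  have hpos : ∀ i, 0 < ‖a i - b i‖ := fun i => norm_pos_iff.2 (sub_ne_zero.2 (hne i))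
  set ν : ℕ → Fin (n + 1) → ℂ := fun i => ((‖a i - b i‖ : ℂ))⁻¹ • (a i - b i) with hν
  have hνmem : ∀ i, ν i ∈ Metric.sphere (0 : Fin (n + 1) → ℂ) 1 := by
    intro i
    simp only [hν, mem_sphere_zero_iff_norm, norm_smul, norm_inv, Complex.norm_real, norm_norm]
    exact inv_mul_cancel₀ (hpos i).ne'
  obtain ⟨v, hv, φ, hφ, hνv⟩ := (isCompact_sphere (0 : Fin (n + 1) → ℂ) 1).tendsto_subseq hνmem
  refine hcrit ⟨hx, v, ?_, ?_, fun f hf => ?_⟩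
  · rintro rfl
    simp at hv
  · have h1 : Tendsto (fun i => ν (φ i) j) atTop (𝓝 (v j)) :=
      ((continuous_apply j).tendsto v).comp hνv
    refine tendsto_nhds_unique h1 ?_
    simp [hν, hab]
  · have hstrict := (MvPolynomial.hasStrictFDerivAt_eval f x).isLittleO
    set L : (Fin (n + 1) → ℂ) →L[ℂ] ℂ := ∑ i, MvPolynomial.eval x (MvPolynomial.pderiv i f) •
        (ContinuousLinearMap.proj i : (Fin (n + 1) → ℂ) →L[ℂ] ℂ) with hL
    have hLv : Tendsto (fun i => L (ν (φ i))) atTop (𝓝 (L v)) := (L.continuous.tendsto v).comp hνv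
    have hab' : Tendsto (fun i => (a i, b i)) atTop (𝓝 (x, x)) := hax'.prodMk_nhds hbx'
    have h0 := (hstrict.comp_tendsto hab').norm_right.tendsto_inv_smul_nhds_zero
    have hzero : Tendsto (fun i => L (ν i)) atTop (𝓝 0) := by
      have h2 := h0.neg
      rw [neg_zero] at h2
      refine h2.congr fun i => ?_
      have e1 : MvPolynomial.eval (a i) f = 0 := by simpa using hf _ (ha i)
      have e2 : MvPolynomial.eval (b i) f = 0 := by simpa using hf _ (hb i)
      simp [hν, e1, e2]
      ring
    have hLv0 : L v = 0 := tendsto_nhds_unique hLv (hzero.comp hφ.tendsto_atTop)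
    simpa [hL, sum_apply] using hLv0

/-- Uniqueness of lifts: inside the zone, a continuous curve in `X` avoiding `x_j = 0` is determined by
its `j`-th coordinate and its value at one parameter. -/
theorem InEndgameZone.lift_unique (hzone : InEndgameZone X j τ) {I : Set ℝ} (hI : IsPreconnected I)
    {γ₁ γ₂ : ℝ → Fin (n + 1) → ℂ} (h1 : ContinuousOn γ₁ I) (h2 : ContinuousOn γ₂ I)
    (hm1 : ∀ s ∈ I, γ₁ s ∈ X) (hm2 : ∀ s ∈ I, γ₂ s ∈ X) (hj : ∀ s ∈ I, γ₁ s j = γ₂ s j)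
    (hne : ∀ s ∈ I, γ₁ s j ≠ 0) (hle : ∀ s ∈ I, ‖γ₁ s j‖ ≤ ‖τ‖) {s₀ : ℝ} (hs₀ : s₀ ∈ I)
    (heq : γ₁ s₀ = γ₂ s₀) : ∀ s ∈ I, γ₁ s = γ₂ s := by
  have : PreconnectedSpace I := isPreconnected_iff_preconnectedSpace.1 hI
  have hc1 : Continuous fun s : I => γ₁ s := continuousOn_iff_continuous_domRestrict.1 h1
  have hc2 : Continuous fun s : I => γ₂ s := continuousOn_iff_continuous_domRestrict.1 h2
  -- the two lifts agree on a closed set, which is open because `x_j` is locally injective on `X`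
  have hclopen : IsClopen {s : I | γ₁ s = γ₂ s} := by
    refine ⟨isClosed_eq hc1 hc2, isOpen_iff_mem_nhds.2 fun s hs => ?_⟩
    have hs' : γ₁ s = γ₂ s := hs
    have hcrit : ¬IsCriticalPoint X j (γ₁ s) := fun h =>
      absurd (hzone.noncritical _ h (hne s s.2)) (not_lt.2 (hle s s.2))
    obtain ⟨U, hU, hinj⟩ := exists_nhds_injOn_coord (hm1 s s.2) hcrit
    filter_upwards [hc1.continuousAt.preimage_mem_nhds hU,
      hc2.continuousAt.preimage_mem_nhds (by rw [← hs']; exact hU)] with t ht1 ht2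
    exact hinj _ ⟨hm1 t t.2, ht1⟩ _ ⟨hm2 t t.2, ht2⟩ (hj t t.2)
  have huniv := hclopen.eq_univ ⟨⟨s₀, hs₀⟩, heq⟩
  intro s hs
  exact (Set.ext_iff.1 huniv ⟨s, hs⟩).2 trivial

end Lifting

/-! ### The path and the circle in the disk parametrization -/

section Path

open Filter Topology

variable {n : ℕ} {X : Set (Fin (n + 1) → ℂ)} {j : Fin (n + 1)} {τ : ℂ} {p : Fin (n + 1) → ℂ}
  {P : ℝ → Fin (n + 1) → ℂ} {m : ℕ} {A : Fin (n + 1) → PowerSeries ℂ}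

/-- No coordinate of the tracked path vanishes identically near `s = 0`. -/
theorem IsTrackedPath.not_eventually_eq_zero (hX : IsIrreducibleCurve X) (hτ : τ ≠ 0)
    (hP : IsTrackedPath X j τ p P) {k : Fin (n + 1)} (hk : ∃ x ∈ X, x k ≠ 0) :
    ¬∀ᶠ s : ℝ in 𝓝[>] 0, P s k = 0 := by
  intro h
  obtain ⟨G, hG0, hG⟩ := hX.exists_relation j k hk
  have hfin : {z : ℂ | (G.coeff 0).IsRoot z}.Finite := Polynomial.finite_setOfPred_isRoot hG0
  have hnhds : ({z : ℂ | (G.coeff 0).IsRoot z} \ {0})ᶜ ∈ 𝓝 (0 : ℂ) :=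
    (hfin.subset Set.sdiff_subset).isClosed.isOpen_compl.mem_nhds (by simp)
  have hlim : Tendsto (fun s : ℝ => τ * (s : ℂ)) (𝓝[>] 0) (𝓝 0) := by
    simpa using tendsto_ofReal_nhdsGT_zero.const_mul τ
  obtain ⟨s, hs0, hs, hsroot⟩ := (h.and (eventually_mem_Ioo_zero_one.and (hlim hnhds))).exists
  refine hsroot ⟨?_, ?_⟩
  · have h1 := hG (P s) (hP.mem s (Set.Ioo_subset_Icc_self hs))
    rw [hs0, hP.coord s (Set.Ioo_subset_Icc_self hs), Polynomial.evalEval, Polynomial.C_0,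
      ← Polynomial.coeff_zero_eq_eval_zero] at h1
    exact h1
  · have : (s : ℂ) ≠ 0 := by exact_mod_cast hs.1.ne'
    simp [hτ, this]

/-- The curve traced on the unit circle by a disk parametrization with `x_j = τ u ^ m`: as `x_j` turns
by the angle `θ`, the parameter `u` turns by `θ / m`. -/
noncomputable def circleCurve (m : ℕ) (A : Fin (n + 1) → PowerSeries ℂ) (θ : ℝ) : Fin (n + 1) → ℂ :=
  fun k => PowerSeries.sumAt (A k) (Complex.exp (Complex.I * (θ / m : ℝ)))

namespace IsDiskParametrization

theorem sumAt_mem (hA : IsDiskParametrization X j τ m A) (hX : IsIrreducibleCurve X)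
    {u : ℂ} (hu : ‖u‖ ≤ 1) :
    (fun k => PowerSeries.sumAt (A k) u) ∈ X := by
  rw [← hX.closed]
  intro f hf
  rw [← PowerSeries.sumAt_aeval (ρ := 1) hA.absConv f (by simpa using hu), hA.aeval_eq_zero f hf]
  simpa using PowerSeries.sumAt_C 0 u

theorem sumAt_coord (hA : IsDiskParametrization X j τ m A) (u : ℂ) :
    PowerSeries.sumAt (A j) u = τ * u ^ m := by
  rw [hA.coord, PowerSeries.sumAt_monomial]

theorem continuousOn_sumAt (hA : IsDiskParametrization X j τ m A) :
    ContinuousOn (fun u k => PowerSeries.sumAt (A k) u) (Metric.closedBall 0 1) :=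
  continuousOn_pi.2 fun k => by simpa using PowerSeries.continuousOn_sumAt (hA.absConv k)

/-- The parametrization follows the tracked path along the whole real radius once it does so near the
center. -/
theorem path_eq_sumAt (hA : IsDiskParametrization X j τ m A)
    (hX : IsIrreducibleCurve X) (hτ : τ ≠ 0)
    (hzone : InEndgameZone X j τ) (hP : IsTrackedPath X j τ p P)
    (hPA : ∀ᶠ u : ℝ in 𝓝[>] 0, ∀ k, P (u ^ m) k = PowerSeries.sumAt (A k) u) :
    ∀ u ∈ Set.Icc (0 : ℝ) 1, P (u ^ m) = fun k => PowerSeries.sumAt (A k) u := by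
  have hmaps : Set.MapsTo (fun u : ℝ => (u : ℂ)) (Set.Icc 0 1) (Metric.closedBall 0 1) := by
    intro u hu
    simpa [abs_of_nonneg hu.1] using hu.2
  have hc2 : ContinuousOn (fun (u : ℝ) k => PowerSeries.sumAt (A k) u) (Set.Icc 0 1) :=
    hA.continuousOn_sumAt.comp Complex.continuous_ofReal.continuousOn hmaps
  have hc1 : ContinuousOn (fun u : ℝ => P (u ^ m)) (Set.Icc 0 1) :=
    hP.continuousOn.comp (continuous_pow m).continuousOn fun u hu =>
      ⟨pow_nonneg hu.1 m, pow_le_one₀ hu.1 hu.2⟩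
  have hpos : ∀ u ∈ Set.Ioc (0 : ℝ) 1, P (u ^ m) = fun k => PowerSeries.sumAt (A k) u := by
    obtain ⟨u₀, hu₀, hu₀1⟩ := (hPA.and eventually_mem_Ioo_zero_one).exists
    have hsub : Set.Ioc (0 : ℝ) 1 ⊆ Set.Icc 0 1 := Set.Ioc_subset_Icc_self
    have hmem : ∀ u ∈ Set.Ioc (0 : ℝ) 1, u ^ m ∈ Set.Icc (0 : ℝ) 1 := fun u hu =>
      ⟨pow_nonneg hu.1.le m, pow_le_one₀ hu.1.le hu.2⟩
    refine hzone.lift_unique isPreconnected_Ioc (hc1.mono hsub) (hc2.mono hsub)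
      (fun u hu => hP.mem _ (hmem u hu))
      (fun u hu => hA.sumAt_mem hX (by simpa using hmaps (hsub hu))) (fun u hu => ?_)
      (fun u hu => ?_) (fun u hu => ?_) (s₀ := u₀) ⟨hu₀1.1, hu₀1.2.le⟩ (funext hu₀)
    · rw [hP.coord _ (hmem u hu), hA.sumAt_coord, Complex.ofReal_pow]
    · rw [hP.coord _ (hmem u hu)]
      have : ((u ^ m : ℝ) : ℂ) ≠ 0 := by exact_mod_cast (pow_pos hu.1 m).ne'
      exact mul_ne_zero hτ this
    · rw [hP.coord _ (hmem u hu), norm_mul, Complex.norm_real]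
      refine mul_le_of_le_one_right (norm_nonneg _) ?_
      rw [Real.norm_of_nonneg (hmem u hu).1]
      exact (hmem u hu).2
  intro u hu
  rcases hu.1.eq_or_lt with rfl | h0
  · have hle : 𝓝[>] (0 : ℝ) ≤ 𝓝[Set.Icc 0 1] 0 := by
      rw [← nhdsWithin_Ioo_eq_nhdsGT (zero_lt_one (α := ℝ))]
      exact nhdsWithin_mono _ Set.Ioo_subset_Icc_self
    have t1 := (hc1 0 hu).tendsto.mono_left hle
    have t2 := (hc2 0 hu).tendsto.mono_left hle
    exact tendsto_nhds_unique_of_eventuallyEq t1 t2 (hPA.mono fun u hu => funext hu)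
  · exact hpos u ⟨h0, hu.2⟩

/-- The image of the unit circle is the continuation of the path around the circle, which is unrolled
`m` times. -/
theorem isCircleContinuation (hA : IsDiskParametrization X j τ m A)
    (hX : IsIrreducibleCurve X) :
    IsCircleContinuation X j τ (fun k => PowerSeries.sumAt (A k) 1) (circleCurve m A) := by
  have hnorm : ∀ θ : ℝ, ‖Complex.exp (Complex.I * (θ / m : ℝ))‖ = 1 := fun θ => by
    rw [mul_comm]; exact Complex.norm_exp_ofReal_mul_I _
  refine ⟨?_, fun θ => hA.sumAt_mem hX (hnorm θ).le, fun θ => ?_, by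
    ext k; simp [circleCurve]⟩
  · exact hA.continuousOn_sumAt.comp_continuous
      (f := fun θ : ℝ => Complex.exp (Complex.I * (θ / m : ℝ))) (by fun_prop)
      fun θ => by simpa using (hnorm θ).le
  · have hm : (m : ℂ) ≠ 0 := by exact_mod_cast hA.pos.ne'
    rw [circleCurve, hA.sumAt_coord, ← Complex.exp_nat_mul]
    congr 2
    push_cast
    field_simp

end IsDiskParametrization

theorem IsCircleContinuation.norm_coord {Q : ℝ → Fin (n + 1) → ℂ}
    (hQ : IsCircleContinuation X j τ p Q) (θ : ℝ) : ‖Q θ j‖ = ‖τ‖ := by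
  rw [hQ.coord, norm_mul, mul_comm Complex.I, Complex.norm_exp_ofReal_mul_I, mul_one]

/-- Two continuations around the circle that agree at one angle agree everywhere. -/
theorem IsCircleContinuation.eq_of_eq (hτ : τ ≠ 0) (hzone : InEndgameZone X j τ)
    {p' : Fin (n + 1) → ℂ} {Q Q' : ℝ → Fin (n + 1) → ℂ} (hQ : IsCircleContinuation X j τ p Q)
    (hQ' : IsCircleContinuation X j τ p' Q') {θ₀ : ℝ} (h : Q θ₀ = Q' θ₀) : Q = Q' := by
  ext1 θ
  refine hzone.lift_unique isPreconnected_univ hQ.continuous.continuousOn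
    hQ'.continuous.continuousOn (fun s _ => hQ.mem s) (fun s _ => hQ'.mem s)
    (fun s _ => by rw [hQ.coord, hQ'.coord]) (fun s _ => ?_) (fun s _ => (hQ.norm_coord s).le)
    (Set.mem_univ θ₀) h θ (Set.mem_univ θ)
  rw [← norm_ne_zero_iff, hQ.norm_coord]
  exact norm_ne_zero_iff.2 hτ

/-- If a continuation returns to its start at the angle `2 π c`, it is periodic with that period. -/
theorem IsCircleContinuation.periodic (hτ : τ ≠ 0) (hzone : InEndgameZone X j τ)
    {Q : ℝ → Fin (n + 1) → ℂ} (hQ : IsCircleContinuation X j τ p Q) {c : ℕ}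
    (hc : Q (2 * Real.pi * c) = p) : Function.Periodic Q (2 * Real.pi * c) := by
  have hshift : IsCircleContinuation X j τ p fun θ => Q (θ + 2 * Real.pi * c) := by
    refine ⟨hQ.continuous.comp (by fun_prop), fun θ => hQ.mem _, fun θ => ?_, by simpa using hc⟩
    rw [hQ.coord]
    congr 1
    have := Complex.exp_periodic.nat_mul c (Complex.I * θ)
    rw [← this]
    congr 1
    push_cast
    ring
  exact fun θ => congrFun (hshift.eq_of_eq hτ hzone hQ (θ₀ := 0) (by simpa [hQ.start] using hc)) θ

end Path

/-! ### Fourier coefficients, cycle number and Cauchy integrals -/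

section Fourier

open Filter

theorem integral_exp_int_mul (e : ℤ) :
    ∫ θ in (0 : ℝ)..(2 * Real.pi), Complex.exp (Complex.I * (e * θ))
      = if e = 0 then 2 * (Real.pi : ℂ) else 0 := by
  split_ifs with he
  · simp [he]
  · have hc : Complex.I * (e : ℂ) ≠ 0 := mul_ne_zero Complex.I_ne_zero (by exact_mod_cast he)
    simp_rw [← mul_assoc]
    rw [integral_exp_mul_complex hc]
    have h1 : Complex.exp (Complex.I * e * ((2 * Real.pi : ℝ) : ℂ)) = 1 :=
      Complex.exp_eq_one_iff.2 ⟨e, by push_cast; ring⟩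
    rw [h1]
    simp

/-- Termwise integration of an absolutely convergent trigonometric series over the circle: only the
terms of frequency zero survive. -/
theorem hasSum_integral_exp {a : ℕ → ℂ} (ha : Summable fun n => ‖a n‖) (e : ℕ → ℤ) {f : ℝ → ℂ}
    (hf : ∀ θ : ℝ, HasSum (fun n => a n * Complex.exp (Complex.I * (e n * θ))) (f θ)) :
    HasSum (fun n => if e n = 0 then a n * (2 * Real.pi) else 0)
      (∫ θ in (0 : ℝ)..(2 * Real.pi), f θ) := by
  have h := intervalIntegral.hasSum_integral_of_dominated_convergence (μ := MeasureTheory.volume)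
    (a := 0) (b := 2 * Real.pi) (F := fun n (θ : ℝ) => a n * Complex.exp (Complex.I * (e n * θ)))
    (f := f) (fun n _ => ‖a n‖)
    (fun n => (by fun_prop : Continuous fun θ : ℝ =>
      a n * Complex.exp (Complex.I * (e n * θ))).aestronglyMeasurable)
    (fun n => Eventually.of_forall fun θ _ => by
      have : Complex.exp (Complex.I * (e n * θ)) = Complex.exp (((e n * θ : ℝ) : ℂ) * Complex.I) := by
        push_cast; ring_nf
      rw [norm_mul, this, Complex.norm_exp_ofReal_mul_I, mul_one])
    (Eventually.of_forall fun _ _ => ha) (by simp)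
    (Eventually.of_forall fun θ _ => hf θ)
  refine h.congr_fun fun n => ?_
  rw [intervalIntegral.integral_const_mul, integral_exp_int_mul, mul_ite, mul_zero]

end Fourier

section Cycle

variable {n : ℕ} {X : Set (Fin (n + 1) → ℂ)} {j : Fin (n + 1)} {τ : ℂ} {m : ℕ}
  {A : Fin (n + 1) → PowerSeries ℂ}

namespace IsDiskParametrization

theorem circleCurve_two_pi_mul (hA : IsDiskParametrization X j τ m A) :
    circleCurve m A (2 * Real.pi * m) = circleCurve m A 0 := by
  have hm : (m : ℝ) ≠ 0 := by exact_mod_cast hA.pos.ne'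
  ext k
  rw [circleCurve, circleCurve, mul_div_cancel_right₀ _ hm]
  congr 1
  rw [show Complex.I * ((2 * Real.pi : ℝ) : ℂ) = 2 * Real.pi * Complex.I by push_cast; ring]
  simp [Complex.exp_two_pi_mul_I]

/-- If the continuation around the circle has period `2 π c`, all exponents `i / m` occurring in the
parametrization become integers after multiplication by `c`. -/
theorem dvd_of_periodic (hA : IsDiskParametrization X j τ m A) {c : ℕ}
    (hc : Function.Periodic (circleCurve m A) (2 * Real.pi * c)) {k : Fin (n + 1)} {N : ℕ}
    (hN : PowerSeries.coeff N (A k) ≠ 0) : m ∣ c * N := by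
  have hm : (m : ℝ) ≠ 0 := by exact_mod_cast hA.pos.ne'
  set ζ : ℂ := Complex.exp (Complex.I * (2 * Real.pi * c / m : ℝ)) with hζ
  have hζn : ‖ζ‖ = 1 := by
    rw [hζ, mul_comm]; exact Complex.norm_exp_ofReal_mul_I _
  have hsum := hA.absConv k
  rw [PowerSeries.mem_absConv] at hsum
  simp only [NNReal.coe_one, Complex.ofReal_one, one_pow, mul_one] at hsum
  have hS : Summable fun i => ‖PowerSeries.coeff i (A k) * (ζ ^ i - 1)‖ := by
    refine Summable.of_nonneg_of_le (fun _ => norm_nonneg _) (fun i => ?_) (hsum.mul_right 2)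
    rw [norm_mul]
    refine mul_le_mul_of_nonneg_left ((norm_sub_le _ _).trans ?_) (norm_nonneg _)
    rw [norm_pow, hζn, one_pow, norm_one]
    norm_num
  -- the series `∑ aᵢ (ζ ^ i - 1) z ^ i` vanishes on the unit circle, hence so do its coefficients
  have hF := hasSum_integral_exp hS (fun i => (i : ℤ) - N) (f := fun _ => 0) fun φ => by
    set z : ℂ := Complex.exp (Complex.I * (φ : ℝ)) with hz
    have hzn : ‖z‖ = 1 := by
      rw [hz, mul_comm]; exact Complex.norm_exp_ofReal_mul_I _
    have e := congrFun (hc (m * φ)) k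
    simp only [circleCurve] at e
    rw [add_div, mul_div_cancel_left₀ _ hm, Complex.ofReal_add, mul_add, Complex.exp_add, ← hz,
      ← hζ] at e
    have h1 := PowerSeries.hasSum_sumAt (ρ := 1) (hA.absConv k) (u := z * ζ)
      (by simp [hzn, hζn])
    have h2 := PowerSeries.hasSum_sumAt (ρ := 1) (hA.absConv k) (u := z) (by simp [hzn])
    have h3 := (h1.sub h2).mul_right (Complex.exp (-(Complex.I * (N * φ))))
    rw [e, sub_self, zero_mul] at h3
    refine h3.congr_fun fun i => ?_
    have hzi : z ^ i * Complex.exp (-(Complex.I * (N * φ)))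
        = Complex.exp (Complex.I * (((i : ℤ) - N : ℤ) * φ)) := by
      rw [hz, ← Complex.exp_nat_mul, ← Complex.exp_add]
      congr 1
      push_cast
      ring
    rw [← hzi, mul_pow]
    ring
  have hval := hF.unique (hasSum_single N fun i hi => if_neg (by omega))
  simp only [intervalIntegral.integral_zero, sub_self, if_true] at hval
  have hζN : ζ ^ N = 1 := by
    have := (mul_eq_zero.1 hval.symm).resolve_right (by simp [Real.pi_ne_zero])
    exact sub_eq_zero.1 ((mul_eq_zero.1 this).resolve_left hN)
  rw [hζ, ← Complex.exp_nat_mul, Complex.exp_eq_one_iff] at hζN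
  obtain ⟨d, hd⟩ := hζN
  have hmc : (m : ℂ) ≠ 0 := by exact_mod_cast hA.pos.ne'
  have hπ : (Real.pi : ℂ) ≠ 0 := by exact_mod_cast Real.pi_ne_zero
  have hI := Complex.I_ne_zero
  push_cast at hd
  have hd' : (c * N : ℂ) = m * d := by
    field_simp at hd
    have h2 : (2 * Real.pi * Complex.I : ℂ) ≠ 0 := by simp [hπ]
    linear_combination hd
  have : ((c * N : ℕ) : ℤ) = m * d := by exact_mod_cast hd'
  exact Int.natCast_dvd_natCast.1 ⟨d, this⟩

/-- The Cauchy integral with index `l` is `2 π` times the coefficient of the parametrization at the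
exponent `m l / c`, or zero if that is not an integer. -/
theorem cauchyIntegral_ne_zero_iff (hA : IsDiskParametrization X j τ m A) {c : ℕ} (hc0 : 0 < c)
    (hc : Function.Periodic (circleCurve m A) (2 * Real.pi * c)) (k : Fin (n + 1)) (l : ℕ) :
    cauchyIntegral (circleCurve m A) c k l ≠ 0
      ↔ ∃ i, PowerSeries.coeff i (A k) ≠ 0 ∧ c * i = m * l := by
  have hm : (m : ℝ) ≠ 0 := by exact_mod_cast hA.pos.ne'
  have hmc : (m : ℂ) ≠ 0 := by exact_mod_cast hA.pos.ne'
  have hsum := hA.absConv k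
  rw [PowerSeries.mem_absConv] at hsum
  simp only [NNReal.coe_one, Complex.ofReal_one, one_pow, mul_one] at hsum
  -- the natural-number division `c * i / m` is exact wherever the coefficient is nonzero
  have hF := hasSum_integral_exp hsum (fun i => ((c * i / m : ℕ) : ℤ) - l)
    (f := fun θ : ℝ => circleCurve m A (c * θ) k / Complex.exp (Complex.I * (θ : ℂ)) ^ l) fun θ => by
    set z : ℂ := Complex.exp (Complex.I * (c * θ / m : ℝ)) with hz
    have hzn : ‖z‖ = 1 := by
      rw [hz, mul_comm]; exact Complex.norm_exp_ofReal_mul_I _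
    refine ((PowerSeries.hasSum_sumAt (ρ := 1) (hA.absConv k) (u := z) (by simp [hzn])).div_const
      (Complex.exp (Complex.I * (θ : ℂ)) ^ l)).congr_fun fun i => ?_
    by_cases hi : PowerSeries.coeff i (A k) = 0
    · simp [hi]
    obtain ⟨d, hd⟩ := hA.dvd_of_periodic hc hi
    rw [hd, Nat.mul_div_cancel_left _ hA.pos, mul_div_assoc]
    congr 1
    rw [hz, ← Complex.exp_nat_mul, ← Complex.exp_nat_mul, ← Complex.exp_sub]
    congr 1
    have hdc : (c * i : ℂ) = m * d := by exact_mod_cast hd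
    push_cast
    field_simp
    linear_combination (-θ : ℂ) * hdc
  constructor
  · intro h
    by_contra! hcon
    refine h (hF.unique ?_)
    convert hasSum_zero using 2 with i
    split_ifs with hi
    · by_cases hi0 : PowerSeries.coeff i (A k) = 0
      · simp [hi0]
      · obtain ⟨d, hd⟩ := hA.dvd_of_periodic hc hi0
        rw [hd, Nat.mul_div_cancel_left _ hA.pos] at hi
        have : d = l := by omega
        exact absurd (this ▸ hd) (hcon i hi0)
    · rfl
  · rintro ⟨i, hi, hil⟩
    have hother : ∀ i' ≠ i, (if ((c * i' / m : ℕ) : ℤ) - l = 0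
        then PowerSeries.coeff i' (A k) * (2 * (Real.pi : ℂ)) else 0) = 0 := by
      intro i' hne
      split_ifs with h
      · by_cases hi0 : PowerSeries.coeff i' (A k) = 0
        · simp [hi0]
        · obtain ⟨d, hd⟩ := hA.dvd_of_periodic hc hi0
          rw [hd, Nat.mul_div_cancel_left _ hA.pos] at h
          have : d = l := by omega
          exact absurd (Nat.eq_of_mul_eq_mul_left hc0 (by rw [hd, this, hil])) hne
      · rfl
    have hval := hF.unique (hasSum_single i hother)
    have hif : ((c * i / m : ℕ) : ℤ) - l = 0 := by
      rw [hil, Nat.mul_div_cancel_left _ hA.pos, sub_self]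
    rw [if_pos hif] at hval
    have hπ : (Real.pi : ℂ) ≠ 0 := by exact_mod_cast Real.pi_ne_zero
    rw [cauchyIntegral, hval]
    exact mul_ne_zero hi (mul_ne_zero two_ne_zero hπ)

/-- The loop of the algorithm for the coordinate `k` stops at `c` times the order of `x_k` as a Puiseux
series in `s = u ^ m`. -/
theorem isLeast_cauchyIntegral_ne_zero (hA : IsDiskParametrization X j τ m A) {c : ℕ} (hc0 : 0 < c)
    (hc : Function.Periodic (circleCurve m A) (2 * Real.pi * c)) {k : Fin (n + 1)} {a : ℕ}
    (ha : IsLeast {i | PowerSeries.coeff i (A k) ≠ 0} a) :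
    IsLeast {l | cauchyIntegral (circleCurve m A) c k l ≠ 0} (c * a / m) := by
  have hdvd := hA.dvd_of_periodic hc ha.1
  simp only [hA.cauchyIntegral_ne_zero_iff hc0 hc]
  refine ⟨⟨a, ha.1, (Nat.mul_div_cancel' hdvd).symm⟩, ?_⟩
  rintro l ⟨i, hi, hil⟩
  refine Nat.div_le_of_le_mul ?_
  rw [← hil]
  exact Nat.mul_le_mul_left c (ha.2 hi)

end IsDiskParametrization

end Cycle

/-! ### The output of the algorithm -/

section Algorithm

variable {n : ℕ} {X : Set (Fin (n + 1) → ℂ)} {j : Fin (n + 1)} {τ : ℂ} {p : Fin (n + 1) → ℂ}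
  {P : ℝ → Fin (n + 1) → ℂ} {m : ℕ} {A : Fin (n + 1) → PowerSeries ℂ}

namespace IsDiskParametrization

theorem isLeast_coord (hA : IsDiskParametrization X j τ m A) (hτ : τ ≠ 0) :
    IsLeast {i | PowerSeries.coeff i (A j) ≠ 0} m := by
  have : {i | PowerSeries.coeff i (A j) ≠ 0} = {m} := by
    ext i
    simp [hA.coord, PowerSeries.coeff_monomial, hτ]
  rw [this]
  exact isLeast_singleton

theorem hasValueAt (hA : IsDiskParametrization X j τ m A)
    (hpath : ∀ u ∈ Set.Icc (0 : ℝ) 1, P (u ^ m) = fun k => PowerSeries.sumAt (A k) u) {s : ℝ}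
    (hs : s ∈ Set.Icc (0 : ℝ) 1) (k : Fin (n + 1)) :
    PuiseuxHasValueAt (PowerSeries.toPuiseux m hA.pos (A k)) s (P s k) := by
  rw [PowerSeries.hasValueAt_toPuiseux_iff hA.pos hs.1]
  have hu : s ^ (1 / (m : ℝ)) ∈ Set.Icc (0 : ℝ) 1 :=
    ⟨Real.rpow_nonneg hs.1 _, Real.rpow_le_one hs.1 hs.2 (by positivity)⟩
  have hP := hpath _ hu
  rw [one_div, Real.rpow_inv_natCast_pow hs.1 hA.pos.ne', ← one_div] at hP
  rw [hP]
  refine PowerSeries.hasSum_sumAt (ρ := 1) (hA.absConv k) ?_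
  rw [Complex.norm_real, Real.norm_of_nonneg hu.1]
  simpa using hu.2

variable {a : Fin (n + 1) → ℕ}

/-- Every output of the algorithm arises from the continuation given by the disk parametrization. -/
theorem exists_of_isAlgorithmOutput (hA : IsDiskParametrization X j τ m A)
    (hX : IsIrreducibleCurve X) (hτ : τ ≠ 0) (hzone : InEndgameZone X j τ)
    (hp : p = fun k => PowerSeries.sumAt (A k) 1)
    (ha : ∀ k, IsLeast {i | PowerSeries.coeff i (A k) ≠ 0} (a k)) {r : Fin (n + 1) → ℕ}
    (hr : IsAlgorithmOutput X j τ p r) :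
    ∃ c : ℕ, IsCycleNumber p (circleCurve m A) c ∧ (∀ k, m ∣ c * a k) ∧
      ∀ k, r k = (c * a k / m) / Finset.univ.gcd fun k => c * a k / m := by
  obtain ⟨Q, c, u, hQ, hc, hu, hr⟩ := hr
  have hcirc : IsCircleContinuation X j τ p (circleCurve m A) := hp ▸ hA.isCircleContinuation hX
  obtain rfl : Q = circleCurve m A :=
    hQ.eq_of_eq hτ hzone hcirc (θ₀ := 0) (hQ.start.trans hcirc.start.symm)
  have hper := hcirc.periodic hτ hzone hc.1.2
  obtain rfl : u = fun k => c * a k / m := funext fun k =>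
    (hu k).unique (hA.isLeast_cauchyIntegral_ne_zero hc.1.1 hper (ha k))
  exact ⟨c, hc, fun k => hA.dvd_of_periodic hper (ha k).1, hr⟩

theorem exists_isAlgorithmOutput (hA : IsDiskParametrization X j τ m A)
    (hX : IsIrreducibleCurve X) (hτ : τ ≠ 0) (hzone : InEndgameZone X j τ)
    (hp : p = fun k => PowerSeries.sumAt (A k) 1)
    (ha : ∀ k, IsLeast {i | PowerSeries.coeff i (A k) ≠ 0} (a k)) :
    ∃ r, IsAlgorithmOutput X j τ p r := by
  classical
  have hcirc : IsCircleContinuation X j τ p (circleCurve m A) := hp ▸ hA.isCircleContinuation hX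
  -- the path closes up after `m` turns, so the cycle number exists
  have hex : ∃ c : ℕ, 0 < c ∧ circleCurve m A (2 * Real.pi * c) = p :=
    ⟨m, hA.pos, hA.circleCurve_two_pi_mul.trans hcirc.start⟩
  have hc : IsCycleNumber p (circleCurve m A) (Nat.find hex) :=
    ⟨Nat.find_spec hex, fun c hc => Nat.find_min' hex hc⟩
  exact ⟨_, _, _, _, hcirc, hc, fun k => hA.isLeast_cauchyIntegral_ne_zero hc.1.1
    (hcirc.periodic hτ hzone hc.1.2) (ha k), fun k => rfl⟩

end IsDiskParametrization

end Algorithm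

theorem mainTheorem4 {n : ℕ} (X : Set (Fin (n + 1) → ℂ)) (hX : IsIrreducibleCurve X)
    (hcoord : ∀ k, ∃ x ∈ X, x k ≠ 0)
    (j : Fin (n + 1)) (τ : ℂ) (hτ : τ ≠ 0) (hzone : InEndgameZone X j τ)
    (p : Fin (n + 1) → ℂ) (P : ℝ → Fin (n + 1) → ℂ) (hP : IsTrackedPath X j τ p P) :
    (∃! r : Fin (n + 1) → ℕ, IsAlgorithmOutput X j τ p r) ∧
    ∀ r : Fin (n + 1) → ℕ, IsAlgorithmOutput X j τ p r →
      Finset.univ.gcd r = 1 ∧ 0 < r j ∧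
      ∃ y : Fin (n + 1) → HahnSeries ℚ ℂ,
        (∀ k, IsPuiseux (y k)) ∧
        y ∈ MvPolynomial.zeroLocus (HahnSeries ℚ ℂ) (MvPolynomial.vanishingIdeal ℂ X) ∧
        (∀ s ∈ Set.Icc (0 : ℝ) 1, ∀ k, PuiseuxHasValueAt (y k) s (P s k)) ∧
        ∀ k, (y k).orderTop = (((r k : ℚ) / (r j : ℚ) : ℚ) : WithTop ℚ) := by
  classical
  obtain ⟨m, A, hA, hPA⟩ := hP.exists_isDiskParametrization hX hcoord hτ hzone
  have hpath := hA.path_eq_sumAt hX hτ hzone hP hPA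
  have hp : p = fun k => PowerSeries.sumAt (A k) 1 := by
    have := hpath 1 (by simp)
    rwa [one_pow, hP.start, Complex.ofReal_one] at this
  have hne : ∀ k, ∃ i, PowerSeries.coeff i (A k) ≠ 0 := by
    intro k
    by_contra! h
    have h0 : A k = 0 := PowerSeries.ext (by simpa using h)
    refine hP.not_eventually_eq_zero hX hτ (hcoord k) ?_
    filter_upwards [eventually_mem_Ioo_zero_one] with s hs
    have hv := hA.hasValueAt hpath (Set.Ioo_subset_Icc_self hs) k
    rw [h0, map_zero] at hv
    refine hv.unique ?_
    simp
  have ha : ∀ k, IsLeast {i | PowerSeries.coeff i (A k) ≠ 0} (Nat.find (hne k)) := fun k =>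
    ⟨Nat.find_spec (hne k), fun i hi => Nat.find_min' (hne k) hi⟩
  set a : Fin (n + 1) → ℕ := fun k => Nat.find (hne k) with ha_def
  have haj : a j = m := (ha j).unique (hA.isLeast_coord hτ)
  refine ⟨?_, fun r hr => ?_⟩
  · obtain ⟨r, hr⟩ := hA.exists_isAlgorithmOutput hX hτ hzone hp ha
    refine ⟨r, hr, fun r' hr' => funext fun k => ?_⟩
    obtain ⟨c, hc, _, hrc⟩ := hA.exists_of_isAlgorithmOutput hX hτ hzone hp ha hr
    obtain ⟨c', hc', _, hrc'⟩ := hA.exists_of_isAlgorithmOutput hX hτ hzone hp ha hr'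
    rw [hrc, hrc', hc.unique hc']
  · obtain ⟨c, hc, hdvd, hrc⟩ := hA.exists_of_isAlgorithmOutput hX hτ hzone hp ha hr
    set u : Fin (n + 1) → ℕ := fun k => c * a k / m with hu
    have huj : u j = c := by
      simp only [hu, haj]
      exact Nat.mul_div_cancel _ hA.pos
    have hc0 : 0 < c := hc.1.1
    set g := Finset.univ.gcd u with hg
    have hgdvd : ∀ k, g ∣ u k := fun k => Finset.gcd_dvd (Finset.mem_univ k)
    have hg0 : 0 < g := Nat.pos_of_dvd_of_pos (huj ▸ hgdvd j) hc0
    have hrfun : r = fun k => u k / g := funext hrc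
    have hrj : 0 < r j := by
      rw [hrfun]
      exact Nat.div_pos (Nat.le_of_dvd (by rw [huj]; exact hc0) (hgdvd j)) hg0
    refine ⟨?_, hrj, fun k => PowerSeries.toPuiseux m hA.pos (A k),
      fun k => PowerSeries.isPuiseux_toPuiseux _ _, fun f hf => ?_,
      fun s hs k => hA.hasValueAt hpath hs k, fun k => ?_⟩
    · rw [hrfun]
      exact Finset.gcd_div_eq_one (Finset.mem_univ j) (huj ▸ hc0.ne')
    · rw [PowerSeries.aeval_toPuiseux, hA.aeval_eq_zero f hf, map_zero]
    · rw [PowerSeries.orderTop_toPuiseux hA.pos (ha k)]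
      congr 1
      have hm : (m : ℚ) ≠ 0 := by exact_mod_cast hA.pos.ne'
      have hcq : (c : ℚ) ≠ 0 := by exact_mod_cast hc0.ne'
      have hgq : (g : ℚ) ≠ 0 := by exact_mod_cast hg0.ne'
      have e1 : (m * u k : ℚ) = c * a k := by exact_mod_cast Nat.mul_div_cancel' (hdvd k)
      rw [hrc, hrc, Nat.cast_div (hgdvd k) hgq, Nat.cast_div (hgdvd j) hgq,
        div_div_div_cancel_right₀ hgq]
      change (a k : ℚ) / m = (u k : ℚ) / (u j : ℚ)
      rw [huj, div_eq_div_iff hm hcq]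
      linear_combination -e1
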